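/- Let $a_1,\dots,a_n\in\mathbb{R}^d$ be points, possibly repeated or affinely dependent, that affinely span $\mathbb{R}^d$; put $v_i=(a_i,1)\in\mathbb{R}^{d+1}$ and $[0,v]=\{\alpha v:0\le\alpha\le1\}$. For $B\subseteq[n]$ let $\Delta_B=\mathrm{conv}\{a_b:b\in B\}$, for $Q\subseteq[n]$ let $\mathrm{conv}_Q(A)=\mathrm{conv}\{a_i:i\notin Q\}$, and for disjoint $I,B\subseteq[n]$ with $|B|=d+1$ and $(a_b)_{b\in B}$ affinely independent let $\Pi_{I,B}=\sum_{i\in I}v_i+\sum_{b\in B}[0,v_b]$, a tile of order $|I|$. A fine zonotopal tiling of $Z(V)=\sum_{i=1}^n[0,v_i]$ is a collection of tiles $\Pi_{I,B}$ (recorded by their labels $(I,B)$) that cover $Z(V)$ and any two of which meet in a common, possibly empty, face $\sum_{j\in J}v_j+\sum_{c\in C}[0,v_c]$ (where a face of $\Pi_{I,B}$ has $C\subseteq B$, $I\subseteq J\subseteq I\cup B$, $J\cap C=\varnothing$, with the same $(J,C)$ for both tiles). It is regular if its tiles are precisely the images, under the projection $\pi:\mathbb{R}^{d+2}\to\mathbb{R}^{d+1}$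 that deletes the $(d+1)$-th coordinate, of the $(d+1)$-dimensional faces of some zonotope in $\mathbb{R}^{d+2}$ that have an outward normal with positive $(d+1)$-th coordinate. Let $h=(h_1,\dots,h_n)$ be real heights that are generic: any $d+2$ of the lifted points $(a_i,h_i)\in\mathbb{R}^{d+1}$ that are affinely dependent lie on a vertical hyperplane (one whose normal has last coordinate $0$). For $Q\subseteq[n]$, a weighted Delaunay triangulation of a region $R$ for the points outside $Q$ is a triangulation of $R$ by nondegenerate simplices $\Delta_B$, $B\cap Q=\varnothing$, such that, with $B$ ordered so that $\det((a_b,1)_{b\in B})>0$, one has $\det((a_b,h_b,1)_{b\in B},(a_i,h_i,1))<0$ for every $i\notin Q\cup B$. Then for every $Q\subseteq[n]$ for which $\mathrm{conv}_Q(A)$ has nonempty interior there is exactly one weighted Delaunay triangulation $\mathcal{T}_Q(h)$ of $\mathrm{conv}_Q(A)$ for the points outside $Q$. Consider the following construction. Start with $\mathcal{I}^{(0)}=\{\varnothing\}$. For $k=0,1,\dots,n-d-1$ let $$\mathcal{P}^{(k)}=\{\Pi_{I,B}:I\in\mathcal{I}^{(k)},\ \Delta_B\in\mathcal{T}_I(h),\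 \Delta_B\subseteq\mathcal{R}(I)\},$$ $$\mathcal{I}^{(k+1)}=\{I\cup\{b\}:\Pi_{I,B}\in\mathcal{P}^{(k)},\ b\in B,\ \mathcal{R}(I\cup\{b\})\ne\varnothing\},$$ where the link region $\mathcal{R}(Q)$ is the closure of the interior of $\mathrm{conv}_Q(A)\setminus\bigcup_{r<|Q|}E^{(r)}(Q)$, and $E^{(r)}(Q)$ is the union of the $\Delta_B$ over the $\Pi_{I,B}\in\mathcal{P}^{(r)}$ with $B\cap Q=\varnothing$ and $I\subseteq Q$. This construction always succeeds: for every $0\le k\le n-d-1$ and $I\in\mathcal{I}^{(k)}$, the hull $\mathrm{conv}_I(A)$ has nonempty interior, $\mathcal{R}(I)\neq\varnothing$, and the simplices of $\mathcal{T}_I(h)$ contained in $\mathcal{R}(I)$ form a weighted Delaunay triangulation of $\mathcal{R}(I)$ for the points outside $I$; and $\mathcal{I}^{(n-d)}=\varnothing$. The result $\mathcal{P}(h)=\bigcup_{k=0}^{n-d-1}\mathcal{P}^{(k)}$ is a regular fine zonotopal tiling of $Z(V)$, its tiles of order $k$ are those in $\mathcal{P}^{(k)}$, and it is the projection of the lower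 hull of the lifted zonotope: with $\tilde v_i=(a_i,h_i,1)$, $Z(\tilde V)=\sum_i[0,\tilde v_i]$ and $\tilde\Pi_{I,B}=\sum_{i\in I}\tilde v_i+\sum_{b\in B}[0,\tilde v_b]$, the tile $\Pi_{I,B}$ belongs to $\mathcal{P}(h)$ if and only if $\tilde\Pi_{I,B}$ is a $(d+1)$-dimensional face of $Z(\tilde V)$ having an outward normal with negative $(d+1)$-th coordinate, and the tiles of $\mathcal{P}(h)$ are exactly the images under $\pi$ of all such faces of $Z(\tilde V)$. -/

import Mathlib

open scoped Pointwise

/-! Point configurations in `ℝ^d` are maps `a : Fin n → (Fin d → ℝ)`; repeated and affinely dependent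
points are allowed.  A height function assigns a height to every index, so repeated points may have
different heights. -/

/-- The projective lift `v_i = (a_i, 1)`. -/
def projLift {d n : ℕ} (a : Fin n → Fin d → ℝ) (i : Fin n) : Fin (d + 1) → ℝ :=
  Fin.snoc (α := fun _ => ℝ) (a i) 1

/-- The lifted point `(a_i, h_i)`. -/
def heightLift {d n : ℕ} (a : Fin n → Fin d → ℝ) (h : Fin n → ℝ) (i : Fin n) :
    Fin (d + 1) → ℝ :=
  Fin.snoc (α := fun _ => ℝ) (a i) (h i)

/-- The lifted vector `(a_i, h_i, 1)`, the projective lift of `(a_i, h_i)`. -/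
def fullLift {d n : ℕ} (a : Fin n → Fin d → ℝ) (h : Fin n → ℝ) : Fin n → Fin (d + 2) → ℝ :=
  projLift (heightLift a h)

/-- The height function is generic: any `d + 2` lifted points that are affinely dependent lie on a
vertical hyperplane, i.e. one whose normal has last coordinate zero. -/
def IsGenericHeight {d n : ℕ} (a : Fin n → Fin d → ℝ) (h : Fin n → ℝ) : Prop :=
  ∀ S : Finset (Fin n), S.card = d + 2 →
    ¬ AffineIndependent ℝ (fun i : S => heightLift a h i) →
    ∃ (N : Fin (d + 1) → ℝ) (c : ℝ), N ≠ 0 ∧ N (Fin.last d) = 0 ∧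
      ∀ i ∈ S, N ⬝ᵥ heightLift a h i = c

/-! ### Simplices and triangulations -/

/-- The convex hull `Δ_B` of the points with index in `B`. -/
def simplexOf {d n : ℕ} (a : Fin n → Fin d → ℝ) (B : Finset (Fin n)) : Set (Fin d → ℝ) :=
  convexHull ℝ (a '' (B : Set (Fin n)))

/-- `ch_Q(A)`, the convex hull of the points with index outside `Q`. -/
def hullOutside {d n : ℕ} (a : Fin n → Fin d → ℝ) (Q : Finset (Fin n)) : Set (Fin d → ℝ) :=
  convexHull ℝ (a '' {i | i ∉ Q})

/-- The index set `B` consists of the vertices of a nondegenerate `d`-simplex. -/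
def IsSimplexIndex {d n : ℕ} (a : Fin n → Fin d → ℝ) (B : Finset (Fin n)) : Prop :=
  B.card = d + 1 ∧ AffineIndependent ℝ (fun b : B => a b)

/-- A triangulation of the region `R` with vertices in the configuration.  The simplices are recorded
through the index sets of their vertices, one index set for each simplex.  Any two simplices meet
in a common, possibly empty, face; the faces of a simplex are the hulls of sets of its vertices. -/
structure IsTriangulation {d n : ℕ} (a : Fin n → Fin d → ℝ) (R : Set (Fin d → ℝ))
    (T : Set (Finset (Fin n))) : Prop where
  simplex : ∀ B ∈ T, IsSimplexIndex a B
  injOn : Set.InjOn (simplexOf a) T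
  cover : ⋃ B ∈ T, simplexOf a B = R
  inter : ∀ B ∈ T, ∀ B' ∈ T, ∃ C ⊆ B, ∃ C' ⊆ B',
    simplexOf a B ∩ simplexOf a B' = simplexOf a C ∧
    simplexOf a B ∩ simplexOf a B' = simplexOf a C'

/-- The weighted Delaunay condition for the simplex `B` among the points with index outside `Q`:
if `B` is ordered so that `det ((a_b, 1)_b) > 0`, then
`det ((a_b, h_b, 1)_b, (a_i, h_i, 1)) < 0` for all `i ∉ Q` that are not in `B`. -/
def DelaunayCondition {d n : ℕ} (a : Fin n → Fin d → ℝ) (h : Fin n → ℝ)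
    (Q B : Finset (Fin n)) : Prop :=
  ∃ e : Fin (d + 1) → Fin n, Finset.univ.image e = B ∧
    0 < Matrix.det (Matrix.of fun r => projLift a (e r)) ∧
    ∀ i, i ∉ Q → i ∉ B →
      Matrix.det (Matrix.of (Fin.snoc (α := fun _ => Fin (d + 2) → ℝ)
        (fun r => fullLift a h (e r)) (fullLift a h i))) < 0

/-- `T` is a weighted Delaunay triangulation, with height function `h`, of the region `R`, for the
subconfiguration of the points with index outside `Q`. -/
structure IsWeightedDelaunay {d n : ℕ} (a : Fin n → Fin d → ℝ) (h : Fin n → ℝ)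
    (Q : Finset (Fin n)) (R : Set (Fin d → ℝ)) (T : Set (Finset (Fin n))) : Prop where
  triangulation : IsTriangulation a R T
  outside : ∀ B ∈ T, Disjoint B Q
  delaunay : ∀ B ∈ T, DelaunayCondition a h Q B

/-! ### Zonotopes and their tilings -/

/-- The zonotope `∑ i, [0, w i]`. -/
def zonotope {m k : ℕ} (w : Fin m → Fin k → ℝ) : Set (Fin k → ℝ) :=
  ∑ i, segment ℝ 0 (w i)

/-- A pair `(I, B)` of index sets, the label of a tile `Π_{I,B}` or of a face of a tile. -/
abbrev TileLabel (n : ℕ) : Type := Finset (Fin n) × Finset (Fin n)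

/-- The parallelepiped `Π_{I,B} = ∑_{i ∈ I} w_i + ∑_{b ∈ B} [0, w_b]`. -/
def tileSet {n k : ℕ} (w : Fin n → Fin k → ℝ) (t : TileLabel n) : Set (Fin k → ℝ) :=
  {∑ i ∈ t.1, w i} + ∑ b ∈ t.2, segment ℝ 0 (w b)

/-- `Π_f` is a face of `Π_t`: it is obtained by fixing some of the coefficients of the segments
of `Π_t` to `0` or to `1`. -/
def IsTileFace {n : ℕ} (f t : TileLabel n) : Prop :=
  f.2 ⊆ t.2 ∧ t.1 ⊆ f.1 ∧ f.1 ⊆ t.1 ∪ t.2 ∧ Disjoint f.1 f.2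

/-- `P` is (the set of labels of) a fine zonotopal tiling of the zonotope of the projective lifts of
`a`: full-dimensional parallelepipeds that cover the zonotope, any two of which meet in a common,
possibly empty, face (with the same label in both, as is standard in the presence of repeated
vectors). -/
structure IsFineZonotopalTiling {d n : ℕ} (a : Fin n → Fin d → ℝ) (P : Set (TileLabel n)) :
    Prop where
  disjoint : ∀ t ∈ P, Disjoint t.1 t.2
  simplex : ∀ t ∈ P, IsSimplexIndex a t.2
  cover : ⋃ t ∈ P, tileSet (projLift a) t = zonotope (projLift a)
  inter : ∀ t ∈ P, ∀ t' ∈ P,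
    tileSet (projLift a) t ∩ tileSet (projLift a) t' = ∅ ∨
    ∃ f : TileLabel n, IsTileFace f t ∧ IsTileFace f t' ∧
      tileSet (projLift a) t ∩ tileSet (projLift a) t' = tileSet (projLift a) f

/-- The `(d+1)`-th of the `d + 2` coordinates. -/
def heightIndex (d : ℕ) : Fin (d + 2) := (Fin.last d).castSucc

/-- The projection `ℝ^(d+2) → ℝ^(d+1)` that removes the `(d+1)`-th coordinate. -/
def dropHeight {d : ℕ} (z : Fin (d + 2) → ℝ) : Fin (d + 1) → ℝ :=
  (heightIndex d).removeNth z

/-- The face of `Z` with outward normal `N`. -/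
def faceInDirection {k : ℕ} (Z : Set (Fin k → ℝ)) (N : Fin k → ℝ) : Set (Fin k → ℝ) :=
  {z ∈ Z | ∀ y ∈ Z, N ⬝ᵥ y ≤ N ⬝ᵥ z}

/-- `F` is a `(d+1)`-dimensional face of the upper hull of the polytope `Z ⊆ ℝ^(d+2)`: it has an
outward normal with positive `(d+1)`-th coordinate. -/
def IsUpperFacet {d : ℕ} (Z F : Set (Fin (d + 2) → ℝ)) : Prop :=
  (∃ N : Fin (d + 2) → ℝ, 0 < N (heightIndex d) ∧ F = faceInDirection Z N) ∧
    Module.finrank ℝ (vectorSpan ℝ F) = d + 1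

/-- `F` is a `(d+1)`-dimensional face of the lower hull of the polytope `Z ⊆ ℝ^(d+2)`: it has an
outward normal with negative `(d+1)`-th coordinate. -/
def IsLowerFacet {d : ℕ} (Z F : Set (Fin (d + 2) → ℝ)) : Prop :=
  (∃ N : Fin (d + 2) → ℝ, N (heightIndex d) < 0 ∧ F = faceInDirection Z N) ∧
    Module.finrank ℝ (vectorSpan ℝ F) = d + 1

/-- The tiles of `P` are precisely the projections of the upper facets of some zonotope
in `ℝ^(d+2)`. -/
def IsRegularTiling {d n : ℕ} (a : Fin n → Fin d → ℝ) (P : Set (TileLabel n)) : Prop :=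
  ∃ (m : ℕ) (w : Fin m → Fin (d + 2) → ℝ),
    tileSet (projLift a) '' P =
      {G | ∃ F, IsUpperFacet (zonotope w) F ∧ G = dropHeight '' F}

/-- The labels `(I, B)` for which the lifted parallelepiped `Π_{I,B}` is a lower facet of the
lifted zonotope. -/
def lowerHullLabels {d n : ℕ} (a : Fin n → Fin d → ℝ) (h : Fin n → ℝ) : Set (TileLabel n) :=
  {t | Disjoint t.1 t.2 ∧ t.2.card = d + 1 ∧
    IsLowerFacet (zonotope (fullLift a h)) (tileSet (fullLift a h) t)}

/-! ### The iterative construction -/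

/-- The region `E^(r)(Q)` computed from a set `P` of tiles: the union of the simplices `Δ_B` over the
tiles `(I, B)` of order `r` with `B ∩ Q = ∅` and `I ⊆ Q`. -/
def linkPart {d n : ℕ} (a : Fin n → Fin d → ℝ) (P : Set (TileLabel n)) (r : ℕ)
    (Q : Finset (Fin n)) : Set (Fin d → ℝ) :=
  ⋃ t ∈ {t : TileLabel n | t ∈ P ∧ t.1.card = r ∧ Disjoint t.2 Q ∧ t.1 ⊆ Q}, simplexOf a t.2

/-- The link region `R(Q)` computed from the tiles of order less than `|Q|`: the (regularized)
difference of `ch_Q(A)` and the regions `E^(r)(Q)` with `r < |Q|`.  The closure of the interior is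
taken because link regions are unions of closed `d`-simplices: this keeps the boundary, and it makes
the region empty if the difference has no interior. -/
def linkRegion {d n : ℕ} (a : Fin n → Fin d → ℝ) (P : Set (TileLabel n))
    (Q : Finset (Fin n)) : Set (Fin d → ℝ) :=
  closure (interior (hullOutside a Q \ ⋃ r ∈ Finset.range Q.card, linkPart a P r Q))

/-- The simplices of `T Q` that lie in the link region of `Q`. -/
def linkSimplices {d n : ℕ} (a : Fin n → Fin d → ℝ) (T : Finset (Fin n) → Set (Finset (Fin n)))
    (P : Set (TileLabel n)) (Q : Finset (Fin n)) : Set (Finset (Fin n)) :=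
  {B ∈ T Q | simplexOf a B ⊆ linkRegion a P Q}

/-- The tiles `(I, B)` with `I` in the given family and `B` a simplex of `T I` in the link
region of `I`. -/
def newTiles {d n : ℕ} (a : Fin n → Fin d → ℝ) (T : Finset (Fin n) → Set (Finset (Fin n)))
    (𝓘 : Set (Finset (Fin n))) (P : Set (TileLabel n)) : Set (TileLabel n) :=
  {t | t.1 ∈ 𝓘 ∧ t.2 ∈ linkSimplices a T P t.1}

/-- The state of the construction before step `k`: the family `𝓘^(k)`, and the set of all the tiles
obtained so far, i.e. those of the steps `0, …, k - 1`. -/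
def constructionState {d n : ℕ} (a : Fin n → Fin d → ℝ)
    (T : Finset (Fin n) → Set (Finset (Fin n))) :
    ℕ → Set (Finset (Fin n)) × Set (TileLabel n)
  | 0 => ({∅}, ∅)
  | k + 1 =>
    let S := constructionState a T k
    let new := newTiles a T S.1 S.2
    ({J | ∃ t ∈ new, ∃ b ∈ t.2, J = insert b t.1 ∧ (linkRegion a (S.2 ∪ new) J).Nonempty},
      S.2 ∪ new)

/-- The family `𝓘^(k)`. -/
def indexFamily {d n : ℕ} (a : Fin n → Fin d → ℝ) (T : Finset (Fin n) → Set (Finset (Fin n)))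
    (k : ℕ) : Set (Finset (Fin n)) :=
  (constructionState a T k).1

/-- The tiles obtained in the steps `0, …, k - 1`. -/
def tilesBefore {d n : ℕ} (a : Fin n → Fin d → ℝ) (T : Finset (Fin n) → Set (Finset (Fin n)))
    (k : ℕ) : Set (TileLabel n) :=
  (constructionState a T k).2

/-- The tiles `𝒫^(k)` obtained in step `k`. -/
def tilesAt {d n : ℕ} (a : Fin n → Fin d → ℝ) (T : Finset (Fin n) → Set (Finset (Fin n)))
    (k : ℕ) : Set (TileLabel n) :=
  newTiles a T (indexFamily a T k) (tilesBefore a T k)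

/-- The result of the construction: the union of the `𝒫^(k)` with `0 ≤ k ≤ n - d - 1`. -/
def constructedTiles {d n : ℕ} (a : Fin n → Fin d → ℝ)
    (T : Finset (Fin n) → Set (Finset (Fin n))) : Set (TileLabel n) :=
  ⋃ k ∈ {k : ℕ | k + d + 1 ≤ n}, tilesAt a T k

/-! Everything is read off from linear functionals `w` on homogeneous coordinates. A functional
sorts the indices by the sign of `w ⬝ᵥ v i - h i` into above, tight and below. Genericity says that
the functional interpolating `h` on a basis `B` is tight on `B` only, so each basis carries exactly
one label `(I, B)`, with `I` its above set. These labels form `basicTiles`, and the theorem amounts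
to recognizing this one set in three guises.

As a tiling: minimizing the height `∑ α i * h i` over the representations `∑ α i • v i = z` with
coefficients in `[0, 1]` is a linear program, and an optimal dual basis gives a tile containing `z`
(`exists_basis_of_mem`). Representations lying in tiles are all of minimal height, so a common point
of two tiles has common coefficients (`basicTiles_inter`).

As a lower hull: a normal with negative height entry is, up to a positive factor, a functional `w`
together with height entry `-1`. Its signs on the lifted generators are the above/tight/below
pattern of `w`, and the face has dimension `d + 1` exactly if the tight set spans (`facet_iff`).
Negating the heights makes the same tiles appear on an upper hull, which gives regularity.

As the output of the construction: the Delaunay simplices for the points outside `Q` are the bases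
disjoint from `Q` whose above set lies in `Q`. Those with above set strictly inside `Q` are exactly
the simplices making up the regions `E^(r)(Q)`; those with above set `Q` carry the tiles labelled
`Q`. Hence the link region is the union of the latter (`linkRegion_basicTiles`). Induction on the
order then identifies each step (`constructionState_eq`), once it is known that every above set of
positive size arises from a tile of the previous order by adding one of its free indices; this is a
pivoting argument (`exists_lower_tile`). -/

/-! ### Bases of a vector configuration and their interpolating functionals -/

/-- The vectors with index in `B` form a basis of `ℝ^m`. -/
def IsVectorBasis {n m : ℕ} (v : Fin n → Fin m → ℝ) (B : Finset (Fin n)) : Prop :=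
  B.card = m ∧ LinearIndepOn ℝ v (B : Set (Fin n))

/-- The vectors with index in `S` are not contained in a hyperplane. -/
def IsSpanningIndex {n m : ℕ} (v : Fin n → Fin m → ℝ) (S : Finset (Fin n)) : Prop :=
  ∀ w : Fin m → ℝ, (∀ i ∈ S, w ⬝ᵥ v i = 0) → w = 0

/-- The values `h` are generic for the vectors `v`: a functional that interpolates `h` on a basis
does not interpolate it at any other index. -/
def IsGenericValue {n m : ℕ} (v : Fin n → Fin m → ℝ) (h : Fin n → ℝ) : Prop :=
  ∀ B, IsVectorBasis v B → ∀ w : Fin m → ℝ, (∀ b ∈ B, w ⬝ᵥ v b = h b) →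
    ∀ i, i ∉ B → w ⬝ᵥ v i ≠ h i

/-- The indices at which the functional `w` takes the value `h`. -/
noncomputable def tightSet {n m : ℕ} (v : Fin n → Fin m → ℝ) (h : Fin n → ℝ) (w : Fin m → ℝ) :
    Finset (Fin n) :=
  {i | w ⬝ᵥ v i = h i}

/-- The indices at which the functional `w` exceeds `h`. -/
noncomputable def aboveSet {n m : ℕ} (v : Fin n → Fin m → ℝ) (h : Fin n → ℝ) (w : Fin m → ℝ) :
    Finset (Fin n) :=
  {i | h i < w ⬝ᵥ v i}

open Classical in
/-- The functional that interpolates `h` on `B`. -/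
noncomputable def interpolant {n m : ℕ} (v : Fin n → Fin m → ℝ) (h : Fin n → ℝ)
    (B : Finset (Fin n)) : Fin m → ℝ :=
  if H : ∃ w : Fin m → ℝ, ∀ b ∈ B, w ⬝ᵥ v b = h b then H.choose else 0

/-- The labels `(I, B)` in which `B` is a basis and `I` consists of the indices below the
interpolant of `B`. -/
def basicTiles {n m : ℕ} (v : Fin n → Fin m → ℝ) (h : Fin n → ℝ) : Set (TileLabel n) :=
  {t | IsVectorBasis v t.2 ∧ t.1 = aboveSet v h (interpolant v h t.2)}

section
variable {n m : ℕ} {v : Fin n → Fin m → ℝ} {h : Fin n → ℝ} {B S : Finset (Fin n)}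

@[simp] lemma mem_tightSet {w : Fin m → ℝ} {i : Fin n} :
    i ∈ tightSet v h w ↔ w ⬝ᵥ v i = h i := by simp [tightSet]

@[simp] lemma mem_aboveSet {w : Fin m → ℝ} {i : Fin n} :
    i ∈ aboveSet v h w ↔ h i < w ⬝ᵥ v i := by simp [aboveSet]

lemma disjoint_aboveSet_tightSet (w : Fin m → ℝ) :
    Disjoint (aboveSet v h w) (tightSet v h w) := by
  rw [Finset.disjoint_left]
  intro i hi hi'
  rw [mem_aboveSet] at hi
  rw [mem_tightSet] at hi'
  linarith

lemma exists_dotProduct_eq (φ : (Fin m → ℝ) →ₗ[ℝ] ℝ) :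
    ∃ w : Fin m → ℝ, ∀ x, w ⬝ᵥ x = φ x := by
  refine ⟨fun j => φ (Pi.single j 1), fun x => ?_⟩
  have hx : x = ∑ j, x j • Pi.single j (1 : ℝ) := by
    ext k
    simp [Pi.single_apply]
  conv_rhs => rw [hx, map_sum]
  simp [dotProduct, mul_comm]

lemma exists_sum_eq_of_mem_span {x : Fin m → ℝ}
    (hx : x ∈ Submodule.span ℝ (v '' (B : Set (Fin n)))) :
    ∃ c : Fin n → ℝ, ∑ b ∈ B, c b • v b = x := by
  obtain ⟨c, hc⟩ := (Submodule.mem_span_image_finset_iff_exists_fun ℝ).1 hx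
  refine ⟨fun b => if hb : b ∈ B then c ⟨b, hb⟩ else 0, ?_⟩
  rw [← hc, ← Finset.sum_coe_sort]
  simp

/-! ### Interpolation on bases and basis exchange -/

namespace IsVectorBasis

lemma span_eq_top (hB : IsVectorBasis v B) : Submodule.span ℝ (v '' B) = ⊤ := by
  have h1 := finrank_span_eq_card (R := ℝ) (b := fun b : B => v b) hB.2
  have h2 : Set.range (fun b : B => v b) = v '' B := by
    ext x; simp
  rw [h2] at h1
  apply Submodule.eq_top_of_finrank_eq
  rw [h1]
  simpa using hB.1

lemma exists_repr (hB : IsVectorBasis v B) (x : Fin m → ℝ) :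
    ∃ c : Fin n → ℝ, ∑ b ∈ B, c b • v b = x := by
  have hx : x ∈ Submodule.span ℝ (v '' B) := by rw [hB.span_eq_top]; trivial
  exact exists_sum_eq_of_mem_span hx

lemma isSpanningIndex (hB : IsVectorBasis v B) : IsSpanningIndex v B := by
  intro w hw
  obtain ⟨c, hc⟩ := hB.exists_repr w
  have : w ⬝ᵥ w = 0 := by
    conv_lhs => rw [← hc, hc]
    nth_rewrite 2 [← hc]
    rw [dotProduct_sum]
    refine Finset.sum_eq_zero fun b hb => ?_
    rw [dotProduct_smul, hw b hb, smul_zero]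
  exact dotProduct_self_eq_zero.1 this

lemma exists_functional (hB : IsVectorBasis v B) (g : Fin n → ℝ) :
    ∃ w : Fin m → ℝ, ∀ b ∈ B, w ⬝ᵥ v b = g b := by
  obtain ⟨φ, hφ⟩ : ∃ φ : (Fin m → ℝ) →ₗ[ℝ] ℝ, ∀ b : B, φ (v b) = g b := by
    have hl : LinearIndependent ℝ (fun b : B => v b) := hB.2
    let bs := Module.Basis.mk hl (by
      have h2 : Set.range (fun b : B => v b) = v '' B := by
        ext x; simp
      rw [h2, hB.span_eq_top])
    refine ⟨bs.constr ℝ (fun b : B => g b), fun b => ?_⟩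
    have : bs b = v b := by simp [bs]
    rw [← this, Module.Basis.constr_basis]
  obtain ⟨w, hw⟩ := exists_dotProduct_eq φ
  exact ⟨w, fun b hb => by rw [hw, ← hφ ⟨b, hb⟩]⟩

lemma interpolant_apply (hB : IsVectorBasis v B) {b : Fin n} (hb : b ∈ B) :
    interpolant v h B ⬝ᵥ v b = h b := by
  have H := hB.exists_functional h
  rw [interpolant, dif_pos H]
  exact H.choose_spec b hb

lemma eq_interpolant (hB : IsVectorBasis v B) {w : Fin m → ℝ} (hw : ∀ b ∈ B, w ⬝ᵥ v b = h b) :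
    w = interpolant v h B := by
  rw [← sub_eq_zero]
  refine hB.isSpanningIndex _ fun b hb => ?_
  rw [sub_dotProduct, hw b hb, hB.interpolant_apply hb, sub_self]

lemma tightSet_eq (hB : IsVectorBasis v B) (hgen : IsGenericValue v h) {w : Fin m → ℝ}
    (hw : ∀ b ∈ B, w ⬝ᵥ v b = h b) : tightSet v h w = B := by
  ext i
  rw [mem_tightSet]
  exact ⟨fun hi => by_contra fun hiB => hgen B hB w hw i hiB hi, hw i⟩

lemma tightSet_interpolant (hB : IsVectorBasis v B) (hgen : IsGenericValue v h) :
    tightSet v h (interpolant v h B) = B :=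
  hB.tightSet_eq hgen fun _ hb => hB.interpolant_apply hb

/-- The functional `g` kills the span of the remaining vectors but not `v i`, so `v i` lies outside
that span. -/
lemma exchange (hB : IsVectorBasis v B) {b i : Fin n} (hb : b ∈ B) (hi : i ∉ B)
    {g : Fin m → ℝ} (hg : ∀ c ∈ B.erase b, g ⬝ᵥ v c = 0) (hgi : g ⬝ᵥ v i ≠ 0) :
    IsVectorBasis v (insert i (B.erase b)) := by
  have hi' : i ∉ B.erase b := fun h => hi (Finset.mem_of_mem_erase h)
  refine ⟨?_, ?_⟩
  · rw [Finset.card_insert_of_notMem hi', Finset.card_erase_of_mem hb, ← hB.1]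
    have := Finset.card_pos.2 ⟨b, hb⟩
    omega
  · rw [Finset.coe_insert, linearIndepOn_insert (by exact_mod_cast hi')]
    refine ⟨hB.2.mono (by simp), fun hmem => hgi ?_⟩
    obtain ⟨c, hc⟩ := exists_sum_eq_of_mem_span hmem
    rw [← hc, dotProduct_sum]
    refine Finset.sum_eq_zero fun b hb => ?_
    rw [dotProduct_smul, hg b hb, smul_zero]

end IsVectorBasis

/-- A maximal independent subset of `S` is a basis: if its span were proper, a nonzero functional
vanishing on it would vanish on all of `S`. -/
lemma IsSpanningIndex.exists_basis (hS : IsSpanningIndex v S) :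
    ∃ B ⊆ S, IsVectorBasis v B := by
  obtain ⟨b, hbS, -, hsp, hli⟩ := exists_linearIndepOn_extension (K := ℝ) (v := v)
    (linearIndepOn_empty ℝ v) (Set.empty_subset (S : Set (Fin n)))
  classical
  have hbf : b.Finite := Set.toFinite b
  refine ⟨hbf.toFinset, ?_, ?_, ?_⟩
  · intro i hi
    exact hbS (by simpa using hi)
  · have htop : Submodule.span ℝ (v '' b) = ⊤ := by
      by_contra hne
      obtain ⟨φ, hφ, hφ0⟩ := Submodule.exists_le_ker_of_lt_top _ (lt_top_iff_ne_top.2 hne)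
      obtain ⟨w, hw⟩ := exists_dotProduct_eq φ
      have h0 := hS w fun i hi => by
        rw [hw]
        exact hφ0 (hsp ⟨i, hi, rfl⟩)
      apply hφ
      ext x
      simp [← hw, h0]
    have h1 := finrank_span_eq_card (R := ℝ) (b := fun i : hbf.toFinset => v i)
      (by simpa [LinearIndepOn] using (by simpa using hli : LinearIndepOn ℝ v (hbf.toFinset : Set _)))
    have h2 : Set.range (fun i : hbf.toFinset => v i) = v '' b := by
      ext x; simp
    rw [h2, htop] at h1
    simpa using h1.symm
  · simpa using hli

/-- Replaces the chosen interpolant by an arbitrary functional with the given sign pattern, the form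
in which pivots and facet normals supply tiles. -/
lemma mem_basicTiles_iff (hgen : IsGenericValue v h) {t : TileLabel n} :
    t ∈ basicTiles v h ↔ IsVectorBasis v t.2 ∧
      ∃ w : Fin m → ℝ, t.1 = aboveSet v h w ∧ t.2 = tightSet v h w := by
  refine ⟨fun ht => ⟨ht.1, _, ht.2, (ht.1.tightSet_interpolant hgen).symm⟩, ?_⟩
  rintro ⟨hB, w, h1, h2⟩
  have : w = interpolant v h t.2 := hB.eq_interpolant fun b hb => by
    rw [h2] at hb
    exact mem_tightSet.1 hb
  exact ⟨hB, this ▸ h1⟩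

lemma disjoint_of_mem_basicTiles (hgen : IsGenericValue v h) {t : TileLabel n}
    (ht : t ∈ basicTiles v h) : Disjoint t.1 t.2 := by
  obtain ⟨-, w, h1, h2⟩ := (mem_basicTiles_iff hgen).1 ht
  rw [h1, h2]
  exact disjoint_aboveSet_tightSet w

/-! ### Pivoting -/

/-- Move from the interpolant of a basis `B` along an edge `w + s g` of the arrangement.  Either
the signs at the indices of `S` outside `B` never change, or there is a first index `i` of `S`
that is hit, and there `i` replaces `b` in the basis. -/
lemma exists_pivot (hgen : IsGenericValue v h) (hB : IsVectorBasis v B) {b : Fin n} (hb : b ∈ B)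
    {w g : Fin m → ℝ} (hw : tightSet v h w = B) (hg : ∀ c ∈ B.erase b, g ⬝ᵥ v c = 0)
    (S : Finset (Fin n)) :
    (∀ s : ℝ, 0 ≤ s → ∀ i ∈ S \ B,
      0 ≤ (w ⬝ᵥ v i - h i) * ((w + s • g) ⬝ᵥ v i - h i)) ∨
    ∃ s : ℝ, 0 < s ∧ ∃ i ∈ S \ B, IsVectorBasis v (insert i (B.erase b)) ∧
      tightSet v h (w + s • g) = insert i (B.erase b) ∧
      ∀ k ∈ S \ B, 0 ≤ (w ⬝ᵥ v k - h k) * ((w + s • g) ⬝ᵥ v k - h k) := by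
  have hexp : ∀ s i, (w + s • g) ⬝ᵥ v i - h i = (w ⬝ᵥ v i - h i) + s * (g ⬝ᵥ v i) := by
    intro s i
    rw [add_dotProduct, smul_dotProduct, smul_eq_mul]; ring
  have hf : ∀ i ∈ S \ B, w ⬝ᵥ v i - h i ≠ 0 := by
    intro i hi h0
    rw [Finset.mem_sdiff, ← hw, mem_tightSet] at hi
    exact hi.2 (sub_eq_zero.1 h0)
  -- The filtered indices are those whose gap to `h` has sign opposite to its velocity along `g`, so
  -- that the gap closes at a positive parameter. The least of these parameters is the first hit.
  by_cases hne : ((S \ B).filter fun i => (w ⬝ᵥ v i - h i) * (g ⬝ᵥ v i) < 0).Nonempty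
  · right
    obtain ⟨i, hi, hmin⟩ := Finset.exists_min_image _
      (fun i => -(w ⬝ᵥ v i - h i) / (g ⬝ᵥ v i)) hne
    rw [Finset.mem_filter] at hi
    obtain ⟨hiS, hneg⟩ := hi
    have hgi : g ⬝ᵥ v i ≠ 0 := by
      rintro h0
      rw [h0, mul_zero] at hneg
      exact lt_irrefl _ hneg
    have hbas := hB.exchange hb (Finset.mem_sdiff.1 hiS).2 hg hgi
    have hpos : ∀ i, (w ⬝ᵥ v i - h i) * (g ⬝ᵥ v i) < 0 →
        0 < -(w ⬝ᵥ v i - h i) / (g ⬝ᵥ v i) := by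
      intro i hi
      have hgi : g ⬝ᵥ v i ≠ 0 := by
        rintro h0
        rw [h0, mul_zero] at hi
        exact lt_irrefl _ hi
      have h2 : 0 < (g ⬝ᵥ v i) ^ 2 := by positivity
      have : -(w ⬝ᵥ v i - h i) / (g ⬝ᵥ v i) =
          -((w ⬝ᵥ v i - h i) * (g ⬝ᵥ v i)) / (g ⬝ᵥ v i) ^ 2 := by
        field_simp
      rw [this]
      exact div_pos (by linarith) h2
    refine ⟨-(w ⬝ᵥ v i - h i) / (g ⬝ᵥ v i), hpos i hneg, i, hiS, hbas, ?_, ?_⟩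
    · refine hbas.tightSet_eq hgen fun c hc => ?_
      rw [← sub_eq_zero, hexp]
      rcases Finset.mem_insert.1 hc with rfl | hc
      · rw [div_mul_cancel₀ _ hgi, add_neg_cancel]
      · have : c ∈ tightSet v h w := hw ▸ Finset.mem_of_mem_erase hc
        rw [hg c hc, mul_zero, add_zero, mem_tightSet.1 this, sub_self]
    · intro k hk
      rw [hexp]
      by_cases hkn : (w ⬝ᵥ v k - h k) * (g ⬝ᵥ v k) < 0
      · have h1 := hmin k (Finset.mem_filter.2 ⟨hk, hkn⟩)
        have hgk : g ⬝ᵥ v k ≠ 0 := by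
          rintro h0
          rw [h0, mul_zero] at hkn
          exact lt_irrefl _ hkn
        have h2 : (w ⬝ᵥ v k - h k) * (g ⬝ᵥ v k) * (-(w ⬝ᵥ v k - h k) / (g ⬝ᵥ v k)) =
            - (w ⬝ᵥ v k - h k) ^ 2 := by
          field_simp
        nlinarith [mul_le_mul_of_nonpos_left h1 hkn.le]
      · have := mul_nonneg (hpos i hneg).le (not_lt.1 hkn)
        nlinarith [sq_nonneg (w ⬝ᵥ v k - h k)]
  · left
    intro s hs i hi
    rw [Finset.not_nonempty_iff_eq_empty, Finset.filter_eq_empty_iff] at hne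
    rw [hexp]
    nlinarith [sq_nonneg (w ⬝ᵥ v i - h i), mul_nonneg hs (not_lt.1 (hne hi))]

/-- Every basic tile of positive order lies above a basic tile of the previous order. -/
lemma exists_lower_tile (hgen : IsGenericValue v h) {t : TileLabel n} (ht : t ∈ basicTiles v h)
    (hne : t.1.Nonempty) (u : Fin m → ℝ) (hu : ∀ i, u ⬝ᵥ v i = 1) :
    ∃ t' ∈ basicTiles v h, ∃ j ∈ t'.2, j ∉ t'.1 ∧ t.1 = insert j t'.1 := by
  classical
  obtain ⟨j₀, hj₀⟩ := hne
  -- Among all tiles with above set `t.1`, take the one whose functional is lowest at a fixed `j₀ ∈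
  -- t.1`; this extremal choice forces the pivot below to remove an index.
  obtain ⟨B, hB, hmin⟩ := Finset.exists_min_image
    (Finset.univ.filter fun B => (t.1, B) ∈ basicTiles v h)
    (fun B => interpolant v h B ⬝ᵥ v j₀) ⟨t.2, by simpa using ht⟩
  simp only [Finset.mem_filter, Finset.mem_univ, true_and] at hB hmin
  have hBb : IsVectorBasis v B := hB.1
  set w := interpolant v h B with hw
  have htight : tightSet v h w = B := hBb.tightSet_interpolant hgen
  have hJ : t.1 = aboveSet v h w := hB.2
  obtain ⟨c, hc⟩ := hBb.exists_repr (v j₀)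
  -- Pairing with `u` shows that the coefficients of `v j₀` sum to 1, so one is positive. Lowering
  -- the functional at that `b` alone then lowers it at `j₀`.
  obtain ⟨b, hbB, hcb⟩ : ∃ b ∈ B, 0 < c b := by
    by_contra! hcon
    have h1 : u ⬝ᵥ v j₀ = ∑ b ∈ B, c b := by
      rw [← hc, dotProduct_sum]
      simp [dotProduct_smul, hu]
    rw [hu] at h1
    linarith [Finset.sum_nonpos hcon]
  obtain ⟨g, hg⟩ := hBb.exists_functional (fun i => if i = b then -1 else 0)
  have hgC : ∀ k ∈ B.erase b, g ⬝ᵥ v k = 0 := fun k hk => by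
    rw [hg k (Finset.mem_of_mem_erase hk), if_neg (Finset.ne_of_mem_erase hk)]
  have hgb : g ⬝ᵥ v b = -1 := by rw [hg b hbB, if_pos rfl]
  have hgj : g ⬝ᵥ v j₀ < 0 := by
    rw [← hc, dotProduct_sum, ← Finset.add_sum_erase _ _ hbB, Finset.sum_eq_zero fun k hk => by
      rw [dotProduct_smul, hgC k hk, smul_zero], dotProduct_smul, hgb, smul_eq_mul]
    linarith
  have hj₀' : h j₀ < w ⬝ᵥ v j₀ := by rwa [hJ, mem_aboveSet] at hj₀
  have hj₀B : j₀ ∉ B := by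
    rw [← htight, mem_tightSet]; exact hj₀'.ne'
  have hexp : ∀ s i, (w + s • g) ⬝ᵥ v i = w ⬝ᵥ v i + s * (g ⬝ᵥ v i) := by
    intro s i
    rw [add_dotProduct, smul_dotProduct, smul_eq_mul]
  rcases exists_pivot hgen hBb hbB htight hgC Finset.univ with hall | ⟨s, hs, i, hi, hbas, hti, hk⟩
  · exfalso
    -- At this parameter the gap at `j₀` equals `-1`, whereas it was positive at the start.
    have h1 := hall ((w ⬝ᵥ v j₀ - h j₀ + 1) / (-(g ⬝ᵥ v j₀)))
      (div_nonneg (by linarith) (by linarith)) j₀ (by simp [hj₀B])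
    rw [hexp] at h1
    have h2 : w ⬝ᵥ v j₀ + (w ⬝ᵥ v j₀ - h j₀ + 1) / (-(g ⬝ᵥ v j₀)) * (g ⬝ᵥ v j₀) - h j₀ = -1 := by
      rw [div_neg, neg_mul, div_mul_cancel₀ _ hgj.ne]
      ring
    rw [h2] at h1
    linarith
  · have hiB : i ∉ B := (Finset.mem_sdiff.1 hi).2
    have hmem : (aboveSet v h (w + s • g), insert i (B.erase b)) ∈ basicTiles v h :=
      (mem_basicTiles_iff hgen).2 ⟨hbas, w + s • g, rfl, hti.symm⟩
    -- away from `i`, the moved functional exceeds `h` at the same indices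
    have habove : ∀ k, k ≠ i → (k ∈ aboveSet v h (w + s • g) ↔ k ∈ aboveSet v h w) := by
      intro k hki
      rw [mem_aboveSet, mem_aboveSet]
      by_cases hkB : k ∈ B
      · have hkw : w ⬝ᵥ v k = h k := by rwa [← htight, mem_tightSet] at hkB
        rw [hexp, hkw]
        by_cases hkb : k = b
        · rw [hkb, hgb]
          constructor <;> intro hh <;> linarith
        · rw [hgC k (Finset.mem_erase.2 ⟨hkb, hkB⟩)]
          simp
      · have hk0 := hk k (by simp [hkB])
        have h1 : w ⬝ᵥ v k - h k ≠ 0 := by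
          intro h0
          apply hkB
          rw [← htight, mem_tightSet]
          linarith
        have h2 : (w + s • g) ⬝ᵥ v k - h k ≠ 0 := by
          intro h0
          have : k ∈ tightSet v h (w + s • g) := by rw [mem_tightSet]; linarith
          rw [hti] at this
          rcases Finset.mem_insert.1 this with h | h
          · exact hki h
          · exact hkB (Finset.mem_of_mem_erase h)
        have h3 := lt_of_le_of_ne hk0 (mul_ne_zero h1 h2).symm
        rw [← sub_pos, ← sub_pos (a := w ⬝ᵥ v k)]
        constructor
        · intro hp
          exact (pos_iff_pos_of_mul_pos h3).2 hp
        · intro hp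
          exact (pos_iff_pos_of_mul_pos h3).1 hp
    have hi' : i ∉ aboveSet v h (w + s • g) := by
      rw [mem_aboveSet]
      have : i ∈ tightSet v h (w + s • g) := by rw [hti]; exact Finset.mem_insert_self _ _
      rw [mem_tightSet] at this
      exact this.not_gt
    -- If the index hit was above, it leaves the above set and becomes tight, which is the tile
    -- sought. If it was below, the above set is unchanged while the value at `j₀` has dropped,
    -- contrary to the choice of `B`.
    by_cases hiJ : i ∈ t.1
    · refine ⟨_, hmem, i, Finset.mem_insert_self _ _, hi', ?_⟩
      ext k
      rw [Finset.mem_insert]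
      by_cases hki : k = i
      · simp [hki, hiJ]
      · simp only [hki, false_or]
        rw [habove k hki, hJ]
    · exfalso
      have heq : aboveSet v h (w + s • g) = t.1 := by
        ext k
        by_cases hki : k = i
        · rw [hki]; exact iff_of_false hi' hiJ
        · rw [habove k hki, hJ]
      rw [heq] at hmem
      have h1 := hmin _ hmem
      have h2 : w + s • g = interpolant v h (insert i (B.erase b)) :=
        hbas.eq_interpolant fun k hk => by
          rw [← hti, mem_tightSet] at hk
          exact hk
      rw [← h2, hexp] at h1
      nlinarith [mul_pos_of_neg_of_neg hgj (neg_lt_zero.2 hs)]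

end

/-! ### Covering the zonotope -/

section
variable {n m : ℕ} {v : Fin n → Fin m → ℝ} {h : Fin n → ℝ}

/-- The dual objective of the linear program that minimizes the height over the representations of
`z` in the zonotope of the vectors with index in `S`. -/
noncomputable def dualObjective (v : Fin n → Fin m → ℝ) (h : Fin n → ℝ) (S : Finset (Fin n))
    (z : Fin m → ℝ) (w : Fin m → ℝ) : ℝ :=
  ∑ i ∈ S, max 0 (w ⬝ᵥ v i - h i) - w ⬝ᵥ z

/-- Weak duality: each term satisfies `α * x ≤ max 0 x` for `α` in `[0, 1]`. -/
lemma le_dualObjective {S : Finset (Fin n)} {z : Fin m → ℝ} {α : Fin n → ℝ}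
    (hα : ∀ i ∈ S, α i ∈ Set.Icc (0 : ℝ) 1) (hz : ∑ i ∈ S, α i • v i = z) (w : Fin m → ℝ) :
    -∑ i ∈ S, α i * h i ≤ dualObjective v h S z w := by
  rw [dualObjective, ← hz, dotProduct_sum, ← Finset.sum_sub_distrib, ← Finset.sum_neg_distrib]
  refine Finset.sum_le_sum fun i hi => ?_
  rw [dotProduct_smul, smul_eq_mul]
  obtain ⟨h0, h1⟩ := hα i hi
  have h2 : α i * (w ⬝ᵥ v i - h i) ≤ max 0 (w ⬝ᵥ v i - h i) := by
    calc α i * (w ⬝ᵥ v i - h i) ≤ α i * max 0 (w ⬝ᵥ v i - h i) :=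
          mul_le_mul_of_nonneg_left (le_max_right _ _) h0
      _ ≤ max 0 (w ⬝ᵥ v i - h i) := mul_le_of_le_one_left (le_max_left _ _) h1
  linarith

/-- As long as no gap outside `B` changes sign, every `max` is linear in `s` along the edge. The
indices above contribute what `z` contains of them, so only the term at `b` and its coefficient `β
b` remain in the slope. -/
lemma dualObjective_add {S B : Finset (Fin n)} {z : Fin m → ℝ} {w g : Fin m → ℝ} {β : Fin n → ℝ}
    {b : Fin n} {ε s : ℝ} (hBS : B ⊆ S) (hw : tightSet v h w = B)
    (hβ : ∑ i ∈ B, β i • v i = z - ∑ i ∈ aboveSet v h w ∩ S, v i) (hb : b ∈ B)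
    (hg : ∀ k ∈ B.erase b, g ⬝ᵥ v k = 0) (hgb : g ⬝ᵥ v b = ε) (hs : 0 ≤ s)
    (hsign : ∀ k ∈ S \ B, 0 ≤ (w ⬝ᵥ v k - h k) * ((w + s • g) ⬝ᵥ v k - h k)) :
    dualObjective v h S z (w + s • g) =
      dualObjective v h S z w + s * (max 0 ε - ε * β b) := by
  classical
  have hexp : ∀ i, (w + s • g) ⬝ᵥ v i - h i = (w ⬝ᵥ v i - h i) + s * (g ⬝ᵥ v i) := by
    intro i
    rw [add_dotProduct, smul_dotProduct, smul_eq_mul]; ring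
  have hterm : ∀ i ∈ S, max 0 ((w + s • g) ⬝ᵥ v i - h i) = max 0 (w ⬝ᵥ v i - h i) +
      ((if i ∈ aboveSet v h w then s * (g ⬝ᵥ v i) else 0) + if i = b then s * max 0 ε else 0) := by
    intro i hi
    by_cases hiB : i ∈ B
    · have h0 : w ⬝ᵥ v i = h i := by rwa [← hw, mem_tightSet] at hiB
      have h1 : i ∉ aboveSet v h w := by rw [mem_aboveSet, h0]; exact lt_irrefl _
      rw [if_neg h1, hexp, h0, sub_self, zero_add, zero_add, max_self, zero_add]
      by_cases hib : i = b
      · rw [if_pos hib, hib, hgb, mul_max_of_nonneg _ _ hs, mul_zero]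
      · rw [if_neg hib, hg i (Finset.mem_erase.2 ⟨hib, hiB⟩), mul_zero, max_self]
    · have hib : i ≠ b := fun h => hiB (h ▸ hb)
      rw [if_neg hib, add_zero]
      have h1 := hsign i (Finset.mem_sdiff.2 ⟨hi, hiB⟩)
      have h2 : w ⬝ᵥ v i - h i ≠ 0 := fun h0 => hiB (by rw [← hw, mem_tightSet]; linarith)
      by_cases hia : i ∈ aboveSet v h w
      · rw [if_pos hia]
        rw [mem_aboveSet, ← sub_pos] at hia
        have h3 : 0 ≤ (w + s • g) ⬝ᵥ v i - h i := nonneg_of_mul_nonneg_right h1 hia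
        rw [max_eq_right h3, max_eq_right hia.le, hexp]
      · rw [if_neg hia]
        rw [mem_aboveSet, ← sub_pos] at hia
        have h3 : w ⬝ᵥ v i - h i < 0 := lt_of_le_of_ne (not_lt.1 hia) h2
        have h4 : (w + s • g) ⬝ᵥ v i - h i ≤ 0 := by
          by_contra hcon
          nlinarith [mul_neg_of_neg_of_pos h3 (not_le.1 hcon)]
        rw [max_eq_left h3.le, max_eq_left h4, add_zero]
  have hgz : g ⬝ᵥ z = ∑ i ∈ S, (if i ∈ aboveSet v h w then g ⬝ᵥ v i else 0) + ε * β b := by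
    have h1 : z = ∑ i ∈ aboveSet v h w ∩ S, v i + ∑ i ∈ B, β i • v i := by rw [hβ]; abel
    rw [h1, dotProduct_add, dotProduct_sum, dotProduct_sum, ← Finset.add_sum_erase _ _ hb,
      Finset.sum_eq_zero (s := B.erase b) fun k hk => by rw [dotProduct_smul, hg k hk, smul_zero],
      dotProduct_smul, hgb, add_zero, ← Finset.sum_filter, Finset.inter_comm,
      Finset.filter_mem_eq_inter, smul_eq_mul, mul_comm ε]
  rw [dualObjective, dualObjective, Finset.sum_congr rfl hterm, Finset.sum_add_distrib,
    Finset.sum_add_distrib, Finset.sum_ite_eq' S b, if_pos (hBS hb), add_dotProduct,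
    smul_dotProduct, hgz, smul_eq_mul]
  have h5 : ∑ i ∈ S, (if i ∈ aboveSet v h w then s * (g ⬝ᵥ v i) else 0) =
      s * ∑ i ∈ S, (if i ∈ aboveSet v h w then g ⬝ᵥ v i else 0) := by
    rw [Finset.mul_sum]
    refine Finset.sum_congr rfl fun i _ => ?_
    split_ifs <;> simp
  rw [h5]
  ring

/-- The basic tiles of the vectors with index in `S` cover their zonotope. -/
lemma exists_basis_of_mem (hgen : IsGenericValue v h) {S : Finset (Fin n)}
    (hS : IsSpanningIndex v S) {z : Fin m → ℝ} {α : Fin n → ℝ}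
    (hα : ∀ i ∈ S, α i ∈ Set.Icc (0 : ℝ) 1) (hz : ∑ i ∈ S, α i • v i = z) :
    ∃ B ⊆ S, IsVectorBasis v B ∧ ∃ β : Fin n → ℝ, (∀ b ∈ B, β b ∈ Set.Icc (0 : ℝ) 1) ∧
      z = ∑ i ∈ aboveSet v h (interpolant v h B) ∩ S, v i + ∑ b ∈ B, β b • v b := by
  classical
  obtain ⟨B₀, hB₀S, hB₀⟩ := hS.exists_basis
  obtain ⟨B, hB, hmin⟩ := Finset.exists_min_image
    (Finset.univ.filter fun B => B ⊆ S ∧ IsVectorBasis v B)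
    (fun B => dualObjective v h S z (interpolant v h B)) ⟨B₀, by simp [hB₀S, hB₀]⟩
  simp only [Finset.mem_filter, Finset.mem_univ, true_and] at hB hmin
  obtain ⟨hBS, hBb⟩ := hB
  set w := interpolant v h B with hw
  have htight : tightSet v h w = B := hBb.tightSet_interpolant hgen
  obtain ⟨β, hβ⟩ := hBb.exists_repr (z - ∑ i ∈ aboveSet v h w ∩ S, v i)
  refine ⟨B, hBS, hBb, β, ?_, by rw [hβ]; abel⟩
  intro b hb
  by_contra hbad
  -- Complementary slackness: a coefficient outside `[0, 1]` yields a descent edge, downwards at `b`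
  -- if it is negative and upwards if it exceeds 1.
  obtain ⟨ε, hε⟩ : ∃ ε : ℝ, max 0 ε - ε * β b < 0 := by
    rw [Set.mem_Icc, not_and_or, not_le, not_le] at hbad
    rcases hbad with h | h
    · exact ⟨-1, by rw [max_eq_left (by norm_num)]; linarith⟩
    · exact ⟨1, by rw [max_eq_right (by norm_num)]; linarith⟩
  obtain ⟨g, hg⟩ := hBb.exists_functional (fun i => if i = b then ε else 0)
  have hgC : ∀ k ∈ B.erase b, g ⬝ᵥ v k = 0 := fun k hk => by
    rw [hg k (Finset.mem_of_mem_erase hk), if_neg (Finset.ne_of_mem_erase hk)]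
  have hgb : g ⬝ᵥ v b = ε := by rw [hg b hb, if_pos rfl]
  rcases exists_pivot hgen hBb hb htight hgC S with hall | ⟨s, hs, i, hi, hbas, hti, hk⟩
  · set D := max 0 ε - ε * β b with hD
    -- On an unbounded edge this parameter brings the objective to 1 below the weak duality bound.
    set s := (dualObjective v h S z w + ∑ i ∈ S, α i * h i + 1) / (-D) with hs
    have hlow := le_dualObjective (h := h) hα hz w
    have hs0 : 0 ≤ s := div_nonneg (by linarith) (by linarith)
    have h1 := dualObjective_add hBS htight hβ hb hgC hgb hs0 (hall s hs0)
    have h2 := le_dualObjective (h := h) hα hz (w + s • g)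
    have h3 : s * D = -(dualObjective v h S z w + ∑ i ∈ S, α i * h i + 1) := by
      rw [hs, div_neg, neg_mul, div_mul_cancel₀ _ hε.ne]
    rw [h1, ← hD, h3] at h2
    linarith
  · have h1 := dualObjective_add hBS htight hβ hb hgC hgb hs.le hk
    have hsub : insert i (B.erase b) ⊆ S := Finset.insert_subset (Finset.mem_sdiff.1 hi).1
      ((Finset.erase_subset _ _).trans hBS)
    have h2 := hmin _ ⟨hsub, hbas⟩
    have h3 : w + s • g = interpolant v h (insert i (B.erase b)) :=
      hbas.eq_interpolant fun k hk => by
        rw [← hti, mem_tightSet] at hk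
        exact hk
    rw [← h3, h1] at h2
    nlinarith [mul_neg_of_pos_of_neg hs hε]

/-! ### Parallelepipeds and faces of zonotopes -/

lemma mem_sum_segment_iff {k : ℕ} {u : Fin n → Fin k → ℝ} {S : Finset (Fin n)} {z : Fin k → ℝ} :
    z ∈ ∑ i ∈ S, segment ℝ 0 (u i) ↔
      ∃ α : Fin n → ℝ, (∀ i ∈ S, α i ∈ Set.Icc (0 : ℝ) 1) ∧ ∑ i ∈ S, α i • u i = z := by
  rw [Set.mem_finsetSum]
  constructor
  · rintro ⟨g, hg, rfl⟩
    have : ∀ i, ∃ c : ℝ, i ∈ S → c ∈ Set.Icc (0 : ℝ) 1 ∧ c • u i = g i := by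
      intro i
      by_cases hi : i ∈ S
      · have h1 := hg hi
        rw [segment_eq_image] at h1
        obtain ⟨c, hc, hc'⟩ := h1
        exact ⟨c, fun _ => ⟨hc, by simpa using hc'⟩⟩
      · exact ⟨0, fun h => absurd h hi⟩
    choose c hc using this
    exact ⟨c, fun i hi => (hc i hi).1, Finset.sum_congr rfl fun i hi => (hc i hi).2⟩
  · rintro ⟨α, hα, rfl⟩
    refine ⟨fun i => α i • u i, fun {i} hi => ?_, rfl⟩
    rw [segment_eq_image]
    exact ⟨α i, hα i hi, by simp⟩

lemma mem_zonotope_iff {k : ℕ} {u : Fin n → Fin k → ℝ} {z : Fin k → ℝ} :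
    z ∈ zonotope u ↔ ∃ α : Fin n → ℝ, (∀ i, α i ∈ Set.Icc (0 : ℝ) 1) ∧ ∑ i, α i • u i = z := by
  rw [zonotope, mem_sum_segment_iff]
  simp

lemma mem_tileSet_iff {k : ℕ} {u : Fin n → Fin k → ℝ} {t : TileLabel n} {z : Fin k → ℝ} :
    z ∈ tileSet u t ↔ ∃ α : Fin n → ℝ, (∀ i ∈ t.2, α i ∈ Set.Icc (0 : ℝ) 1) ∧
      ∑ i ∈ t.1, u i + ∑ i ∈ t.2, α i • u i = z := by
  rw [tileSet, Set.singleton_add]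
  simp only [Set.mem_image, mem_sum_segment_iff]
  constructor
  · rintro ⟨-, ⟨α, hα, rfl⟩, rfl⟩
    exact ⟨α, hα, rfl⟩
  · rintro ⟨α, hα, rfl⟩
    exact ⟨_, ⟨α, hα, rfl⟩, rfl⟩

/-- The coefficient vectors of the points of the tile with label `t`. -/
def tileCoeffs (t : TileLabel n) : Set (Fin n → ℝ) :=
  {α | (∀ i, α i ∈ Set.Icc (0 : ℝ) 1) ∧ (∀ i ∈ t.1, α i = 1) ∧
    ∀ i, i ∉ t.1 → i ∉ t.2 → α i = 0}

/-- Extends coefficients to all indices, 1 on `t.1` and 0 outside the label, so that points of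
different tiles can be compared. -/
lemma mem_tileSet_iff_of_disjoint {k : ℕ} {u : Fin n → Fin k → ℝ} {t : TileLabel n}
    (ht : Disjoint t.1 t.2) {z : Fin k → ℝ} :
    z ∈ tileSet u t ↔ ∃ α ∈ tileCoeffs t, ∑ i, α i • u i = z := by
  classical
  have key : ∀ α : Fin n → ℝ, (∀ i ∈ t.1, α i = 1) → (∀ i, i ∉ t.1 → i ∉ t.2 → α i = 0) →
      ∑ i, α i • u i = ∑ i ∈ t.1, u i + ∑ i ∈ t.2, α i • u i := by
    intro α h1 h0
    have h2 : ∑ i ∈ t.1, u i = ∑ i ∈ t.1, α i • u i :=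
      Finset.sum_congr rfl fun i hi => by rw [h1 i hi, one_smul]
    rw [h2, ← Finset.sum_union ht]
    refine (Finset.sum_subset (Finset.subset_univ _) fun i _ hi => ?_).symm
    rw [Finset.mem_union, not_or] at hi
    rw [h0 i hi.1 hi.2, zero_smul]
  rw [mem_tileSet_iff]
  constructor
  · rintro ⟨α, hα, rfl⟩
    refine ⟨fun i => if i ∈ t.1 then 1 else if i ∈ t.2 then α i else 0, ⟨?_, ?_, ?_⟩, ?_⟩
    · intro i
      dsimp only
      split_ifs with h1 h2
      · simp
      · exact hα i h2
      · simp
    · intro i hi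
      exact if_pos hi
    · intro i h1 h2
      simp [h1, h2]
    · rw [key]
      · congr 1
        refine Finset.sum_congr rfl fun i hi => ?_
        rw [if_neg (Finset.disjoint_right.1 ht hi), if_pos hi]
      · intro i hi
        exact if_pos hi
      · intro i h1 h2
        simp [h1, h2]
  · rintro ⟨α, ⟨h01, h1, h0⟩, rfl⟩
    exact ⟨α, fun i _ => h01 i, (key α h1 h0).symm⟩

lemma tileSet_subset_zonotope {k : ℕ} {u : Fin n → Fin k → ℝ} {t : TileLabel n}
    (ht : Disjoint t.1 t.2) : tileSet u t ⊆ zonotope u := by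
  intro z hz
  obtain ⟨α, hα, rfl⟩ := (mem_tileSet_iff_of_disjoint ht).1 hz
  exact mem_zonotope_iff.2 ⟨α, hα.1, rfl⟩

/-- A coefficient vector maximizes `∑ α i * x i` over the cube exactly if it is `1` where `x` is
positive and `0` where `x` is negative. -/
lemma sum_mul_eq_sum_max_iff {α x : Fin n → ℝ} (hα : ∀ i, α i ∈ Set.Icc (0 : ℝ) 1) :
    ∑ i, α i * x i = ∑ i, max 0 (x i) ↔
      (∀ i, 0 < x i → α i = 1) ∧ ∀ i, x i < 0 → α i = 0 := by
  have hle : ∀ i ∈ Finset.univ, α i * x i ≤ max 0 (x i) := fun i _ =>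
    (mul_le_mul_of_nonneg_left (le_max_right _ _) (hα i).1).trans
      (mul_le_of_le_one_left (le_max_left _ _) (hα i).2)
  rw [Finset.sum_eq_sum_iff_of_le hle]
  constructor
  · intro H
    constructor
    · intro i hi
      have h1 := H i (Finset.mem_univ _)
      rw [max_eq_right hi.le] at h1
      exact (mul_eq_right₀ hi.ne').1 h1
    · intro i hi
      have h1 := H i (Finset.mem_univ _)
      rw [max_eq_left hi.le] at h1
      exact (mul_eq_zero.1 h1).resolve_right hi.ne
  · rintro ⟨h1, h0⟩ i -
    rcases lt_trichotomy (x i) 0 with hx | hx | hx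
    · rw [h0 i hx, max_eq_left hx.le, zero_mul]
    · rw [hx, max_self, mul_zero]
    · rw [h1 i hx, max_eq_right hx.le, one_mul]

lemma sum_mul_le_sum_max {α x : Fin n → ℝ} (hα : ∀ i, α i ∈ Set.Icc (0 : ℝ) 1) :
    ∑ i, α i * x i ≤ ∑ i, max 0 (x i) :=
  Finset.sum_le_sum fun i _ => (mul_le_mul_of_nonneg_left (le_max_right _ _) (hα i).1).trans
      (mul_le_of_le_one_left (le_max_left _ _) (hα i).2)

/-- Turns the combinatorial conditions on the coefficients into optimality of a linear function,
which can be tested by a value alone. -/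
lemma tileCoeffs_eq {t : TileLabel n} {x : Fin n → ℝ} (h1 : ∀ i, i ∈ t.1 ↔ 0 < x i)
    (h2 : ∀ i, i ∈ t.2 ↔ x i = 0) :
    tileCoeffs t = {α | (∀ i, α i ∈ Set.Icc (0 : ℝ) 1) ∧
      ∑ i, α i * x i = ∑ i, max 0 (x i)} := by
  ext α
  constructor
  · rintro ⟨h01, hp, hn⟩
    refine ⟨h01, (sum_mul_eq_sum_max_iff h01).2 ⟨fun i hi => hp i ((h1 i).2 hi), fun i hi => ?_⟩⟩
    refine hn i ?_ ?_
    · rw [h1]; exact hi.not_gt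
    · rw [h2]; exact hi.ne
  · rintro ⟨h01, H⟩
    rw [sum_mul_eq_sum_max_iff h01] at H
    refine ⟨h01, fun i hi => H.1 i ((h1 i).1 hi), fun i hi1 hi2 => H.2 i ?_⟩
    rw [h1] at hi1
    rw [h2] at hi2
    exact lt_of_le_of_ne (not_lt.1 hi1) hi2

/-- A linear functional on the zonotope pulls back to one on the cube of coefficients, where it is
maximized coordinate by coordinate. -/
lemma faceInDirection_zonotope {k : ℕ} {u : Fin n → Fin k → ℝ} {N : Fin k → ℝ} {t : TileLabel n}
    (h1 : ∀ i, i ∈ t.1 ↔ 0 < N ⬝ᵥ u i) (h2 : ∀ i, i ∈ t.2 ↔ N ⬝ᵥ u i = 0) :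
    faceInDirection (zonotope u) N = tileSet u t := by
  have hdis : Disjoint t.1 t.2 := by
    rw [Finset.disjoint_left]
    intro i hi hi'
    rw [h1] at hi
    rw [h2] at hi'
    linarith
  have hdot : ∀ α : Fin n → ℝ, N ⬝ᵥ ∑ i, α i • u i = ∑ i, α i * (N ⬝ᵥ u i) := by
    intro α
    rw [dotProduct_sum]
    simp [dotProduct_smul]
  ext z
  rw [mem_tileSet_iff_of_disjoint hdis, tileCoeffs_eq h1 h2]
  constructor
  · rintro ⟨hz, hmax⟩
    obtain ⟨α, hα, rfl⟩ := mem_zonotope_iff.1 hz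
    refine ⟨α, ⟨hα, le_antisymm (sum_mul_le_sum_max hα) ?_⟩, rfl⟩
    classical
    let γ : Fin n → ℝ := fun i => if 0 < N ⬝ᵥ u i then 1 else 0
    have hγ : ∀ i, γ i ∈ Set.Icc (0 : ℝ) 1 := by
      intro i
      by_cases hi : 0 < N ⬝ᵥ u i <;> simp [γ, hi]
    have h3 := hmax (∑ i, γ i • u i) (mem_zonotope_iff.2 ⟨γ, hγ, rfl⟩)
    rw [hdot, hdot, (sum_mul_eq_sum_max_iff hγ).2 ⟨fun i hi => if_pos hi,
      fun i hi => if_neg hi.not_gt⟩] at h3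
    exact h3
  · rintro ⟨α, ⟨hα, heq⟩, rfl⟩
    refine ⟨mem_zonotope_iff.2 ⟨α, hα, rfl⟩, fun y hy => ?_⟩
    obtain ⟨γ, hγ, rfl⟩ := mem_zonotope_iff.1 hy
    rw [hdot, hdot, heq]
    exact sum_mul_le_sum_max hγ

/-- A parallelepiped that is a face of a zonotope, and has the right number of free coefficients,
has the label that is determined by the normal. -/
lemma label_eq_of_tileSet_eq {k : ℕ} {u : Fin n → Fin k → ℝ} {N : Fin k → ℝ} {t t' : TileLabel n}
    (h1 : ∀ i, i ∈ t.1 ↔ 0 < N ⬝ᵥ u i) (h2 : ∀ i, i ∈ t.2 ↔ N ⬝ᵥ u i = 0)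
    (hd : Disjoint t'.1 t'.2) (hcard : t.2.card = t'.2.card)
    (heq : tileSet u t' ⊆ tileSet u t) : t' = t := by
  classical
  have hdis : Disjoint t.1 t.2 := by
    rw [Finset.disjoint_left]
    intro i hi hi'
    rw [h1] at hi
    rw [h2] at hi'
    linarith
  -- The vectors may be dependent, so a point can have several representations. All of them give the
  -- same value of `N`, and this value decides membership in `tileCoeffs t`.
  have hsub : tileCoeffs t' ⊆ tileCoeffs t := by
    intro α hα
    have h3 := heq ((mem_tileSet_iff_of_disjoint hd).2 ⟨α, hα, rfl⟩)
    obtain ⟨γ, hγ, hγα⟩ := (mem_tileSet_iff_of_disjoint hdis).1 h3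
    rw [tileCoeffs_eq h1 h2] at hγ ⊢
    refine ⟨hα.1, ?_⟩
    rw [← hγ.2]
    have h4 := congrArg (N ⬝ᵥ ·) hγα
    simp only [dotProduct_sum, dotProduct_smul, smul_eq_mul] at h4
    exact h4.symm
  have hmem : ∀ x ∈ Set.Icc (0 : ℝ) 1, (fun i => if i ∈ t'.1 then 1 else if i ∈ t'.2 then x else 0)
      ∈ tileCoeffs t := by
    intro x hx
    refine hsub ⟨fun i => ?_, fun i hi => if_pos hi, fun i hi1 hi2 => by simp [hi1, hi2]⟩
    dsimp only
    split_ifs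
    · simp
    · exact hx
    · simp
  -- The centre of the tile: its coefficients 1, 1/2 and 0 reveal the label.
  have hhalf := hmem (1 / 2) (by norm_num)
  have hB : t'.2 ⊆ t.2 := by
    intro i hi
    have hi1 := Finset.disjoint_right.1 hd hi
    by_contra hcon
    by_cases hit : i ∈ t.1
    · have := hhalf.2.1 i hit
      norm_num [hi1, hi] at this
    · have := hhalf.2.2 i hit hcon
      norm_num [hi1, hi] at this
  have hB' : t'.2 = t.2 := Finset.eq_of_subset_of_card_le hB hcard.le
  refine Prod.ext (Finset.ext fun i => ?_) hB'
  constructor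
  · intro hi
    by_contra hcon
    have := hhalf.2.2 i hcon (by rw [← hB']; exact Finset.disjoint_left.1 hd hi)
    norm_num [hi] at this
  · intro hi
    by_contra hcon
    have := hhalf.2.1 i hi
    have hi2 : i ∉ t'.2 := by rw [hB']; exact Finset.disjoint_left.1 hdis hi
    norm_num [hcon, hi2] at this

lemma vectorSpan_tileSet {k : ℕ} (u : Fin n → Fin k → ℝ) (t : TileLabel n) :
    vectorSpan ℝ (tileSet u t) = Submodule.span ℝ (u '' t.2) := by
  classical
  apply le_antisymm
  · rw [vectorSpan_def, Submodule.span_le]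
    rintro _ ⟨x, hx, y, hy, rfl⟩
    obtain ⟨α, -, rfl⟩ := mem_tileSet_iff.1 hx
    obtain ⟨β, -, rfl⟩ := mem_tileSet_iff.1 hy
    have : (∑ i ∈ t.1, u i + ∑ i ∈ t.2, α i • u i) -ᵥ (∑ i ∈ t.1, u i + ∑ i ∈ t.2, β i • u i) =
        ∑ i ∈ t.2, α i • u i - ∑ i ∈ t.2, β i • u i := by
      rw [vsub_eq_sub]; abel
    dsimp only
    rw [this]
    have hmem : ∀ γ : Fin n → ℝ, ∑ i ∈ t.2, γ i • u i ∈ Submodule.span ℝ (u '' t.2) :=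
      fun γ => Submodule.sum_mem _ fun i hi =>
        Submodule.smul_mem _ _ (Submodule.subset_span ⟨i, hi, rfl⟩)
    exact Submodule.sub_mem _ (hmem α) (hmem β)
  · rw [Submodule.span_le]
    rintro _ ⟨b, hb, rfl⟩
    have hb' : b ∈ t.2 := hb
    have h0 : ∑ i ∈ t.1, u i ∈ tileSet u t :=
      mem_tileSet_iff.2 ⟨0, fun i _ => by simp, by simp⟩
    have h1 : ∑ i ∈ t.1, u i + u b ∈ tileSet u t := by
      refine mem_tileSet_iff.2 ⟨fun i => if i = b then 1 else 0, fun i _ => ?_, by simp [hb']⟩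
      by_cases hib : i = b <;> simp [hib]
    have := vsub_mem_vectorSpan ℝ h1 h0
    simpa using this

end

/-! ### Homogeneous coordinates -/

/-- The vector `(x, 1)`. -/
def homogenize {d : ℕ} (x : Fin d → ℝ) : Fin (d + 1) → ℝ :=
  Fin.snoc (α := fun _ => ℝ) x 1

section
variable {d n : ℕ} {a : Fin n → Fin d → ℝ} {h : Fin n → ℝ} {B Q : Finset (Fin n)}

lemma projLift_eq (a : Fin n → Fin d → ℝ) (i : Fin n) : projLift a i = homogenize (a i) := rfl

@[simp] lemma homogenize_castSucc (x : Fin d → ℝ) (j : Fin d) : homogenize x j.castSucc = x j := by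
  simp [homogenize]

@[simp] lemma homogenize_last (x : Fin d → ℝ) : homogenize x (Fin.last d) = 1 := by
  simp [homogenize]

lemma dotProduct_homogenize (w : Fin (d + 1) → ℝ) (x : Fin d → ℝ) :
    w ⬝ᵥ homogenize x = (fun j => w (Fin.castSucc j)) ⬝ᵥ x + w (Fin.last d) := by
  simp [dotProduct, Fin.sum_univ_castSucc]

lemma single_last_dotProduct_projLift (i : Fin n) :
    Pi.single (Fin.last d) (1 : ℝ) ⬝ᵥ projLift a i = 1 := by
  simp [projLift_eq]

lemma sum_smul_homogenize_eq_iff {ι : Type*} (s : Finset ι) (c : ι → ℝ) (p : ι → Fin d → ℝ)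
    (z : Fin (d + 1) → ℝ) :
    ∑ i ∈ s, c i • homogenize (p i) = z ↔
      ∑ i ∈ s, c i • p i = (fun j => z (Fin.castSucc j)) ∧ ∑ i ∈ s, c i = z (Fin.last d) := by
  constructor
  · rintro rfl
    constructor
    · ext j
      simp [Finset.sum_apply]
    · simp [Finset.sum_apply]
  · rintro ⟨h1, h2⟩
    ext j
    refine Fin.lastCases ?_ (fun j => ?_) j
    · simp [Finset.sum_apply, ← h2]
    · have := congrFun h1 j
      simpa [Finset.sum_apply] using this

lemma sum_smul_projLift_eq_homogenize_iff (s : Finset (Fin n)) (c : Fin n → ℝ) (x : Fin d → ℝ) :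
    ∑ i ∈ s, c i • projLift a i = homogenize x ↔
      ∑ i ∈ s, c i • a i = x ∧ ∑ i ∈ s, c i = 1 := by
  have := sum_smul_homogenize_eq_iff s c a (homogenize x)
  simpa [projLift_eq] using this

lemma affineIndependent_iff_linearIndependent_homogenize {ι : Type*} [Fintype ι]
    (p : ι → Fin d → ℝ) :
    AffineIndependent ℝ p ↔ LinearIndependent ℝ (fun i => homogenize (p i)) := by
  rw [affineIndependent_iff_of_fintype, Fintype.linearIndependent_iff]
  refine forall_congr' fun c => ?_
  rw [sum_smul_homogenize_eq_iff]
  constructor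
  · rintro H ⟨h1, h2⟩
    refine H (by simpa using h2) ?_
    rw [Finset.weightedVSub_eq_linear_combination _ (by simpa using h2), h1]
    rfl
  · intro H h1 h2
    refine H ⟨?_, by simpa using h1⟩
    rw [Finset.weightedVSub_eq_linear_combination _ h1] at h2
    rw [h2]
    rfl

lemma isSimplexIndex_iff : IsSimplexIndex a B ↔ IsVectorBasis (projLift a) B :=
  and_congr Iff.rfl (affineIndependent_iff_linearIndependent_homogenize _)

/-- If the interpolant of `B` were also tight at `i`, the lifted point of `i` would be an affine
combination of those of `B`. The resulting vertical hyperplane would put the nondegenerate simplex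
`B` inside a hyperplane of `ℝ^d`. -/
lemma isGenericValue_of_isGenericHeight (hgen : IsGenericHeight a h) :
    IsGenericValue (projLift a) h := by
  classical
  intro B hB w hw i hi heq
  obtain ⟨c, hc⟩ := hB.exists_repr (projLift a i)
  rw [projLift_eq a i, sum_smul_projLift_eq_homogenize_iff] at hc
  have hhi : h i = ∑ b ∈ B, c b * h b := by
    have h1 : projLift a i = ∑ b ∈ B, c b • projLift a b := by
      rw [projLift_eq a i, eq_comm, sum_smul_projLift_eq_homogenize_iff]; exact hc
    rw [← heq, h1, dotProduct_sum]
    exact Finset.sum_congr rfl fun b hb => by rw [dotProduct_smul, hw b hb, smul_eq_mul]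
  obtain ⟨N, e, hN0, hNl, hN⟩ := hgen (insert i B)
    (by rw [Finset.card_insert_of_notMem hi, hB.1]) (by
      rw [affineIndependent_iff_linearIndependent_homogenize]
      intro hli
      have hli' : LinearIndepOn ℝ (fun i => homogenize (heightLift a h i))
        ((insert i B : Finset (Fin n)) : Set (Fin n)) := hli
      rw [linearIndepOn_finset_iff] at hli'
      have := hli' (fun k => if k = i then -1 else c k) (by
        rw [Finset.sum_insert hi, if_pos rfl, Finset.sum_congr rfl fun b hb => by
          rw [if_neg (show b ≠ i from fun h => hi (h ▸ hb))], neg_smul, one_smul,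
          neg_add_eq_zero, eq_comm, sum_smul_homogenize_eq_iff]
        refine ⟨?_, by simpa using hc.2⟩
        ext j
        refine Fin.lastCases ?_ (fun j => ?_) j
        · simpa [heightLift, Finset.sum_apply] using hhi.symm
        · have := congrFun hc.1 j
          simpa [heightLift, Finset.sum_apply] using this) i (Finset.mem_insert_self _ _)
      simp at this)
  -- The vertical hyperplane, read as a functional on homogeneous coordinates, vanishes on the basis
  -- `B`.
  let N' : Fin (d + 1) → ℝ := Fin.snoc (α := fun _ => ℝ) (fun j => N (Fin.castSucc j)) (-e)
  have hN' : N' = 0 := hB.isSpanningIndex _ fun b hb => by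
    have h1 := hN b (Finset.mem_insert_of_mem hb)
    rw [projLift_eq, dotProduct_homogenize]
    simp only [dotProduct, Fin.sum_univ_castSucc, hNl, zero_mul, add_zero] at h1
    simp only [heightLift, Fin.snoc_castSucc] at h1
    simp [N', dotProduct, h1]
  apply hN0
  ext j
  refine Fin.lastCases hNl (fun j => ?_) j
  have := congrFun hN' j.castSucc
  simpa [N'] using this

/-! ### The lifted vectors -/

@[simp] lemma fullLift_heightIndex (i : Fin n) : fullLift a h i (heightIndex d) = h i := by
  simp [fullLift, projLift_eq, heightIndex, heightLift]

lemma heightIndex_succAbove_last : (heightIndex d).succAbove (Fin.last d) = Fin.last (d + 1) := by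
  rw [heightIndex, Fin.succAbove_castSucc_self, Fin.succ_last]

lemma heightIndex_succAbove_castSucc (j : Fin d) :
    (heightIndex d).succAbove j.castSucc = j.castSucc.castSucc := by
  rw [heightIndex, Fin.succAbove_castSucc_of_lt]
  exact Fin.castSucc_lt_last j

@[simp] lemma fullLift_succAbove (i : Fin n) (j : Fin (d + 1)) :
    fullLift a h i ((heightIndex d).succAbove j) = projLift a i j := by
  refine Fin.lastCases ?_ (fun j => ?_) j
  · rw [heightIndex_succAbove_last]
    simp [fullLift, projLift_eq]
  · rw [heightIndex_succAbove_castSucc]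
    simp [fullLift, projLift_eq, heightLift]

lemma dotProduct_fullLift (N : Fin (d + 2) → ℝ) (i : Fin n) :
    N ⬝ᵥ fullLift a h i = N (heightIndex d) * h i + dropHeight N ⬝ᵥ projLift a i := by
  rw [dotProduct, Fin.sum_univ_succAbove _ (heightIndex d)]
  simp [dotProduct, dropHeight, Fin.removeNth]

/-- Subtracting from the height column the combination of the other columns given by `w` leaves only
`h i - w ⬝ᵥ projLift a i` in the last row. Expansion along that column contributes the sign
`(-1)^(2d+1)`. -/
lemma det_fullLift {e : Fin (d + 1) → Fin n} {w : Fin (d + 1) → ℝ}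
    (hw : ∀ r, w ⬝ᵥ projLift a (e r) = h (e r)) (i : Fin n) :
    Matrix.det (Matrix.of (Fin.snoc (α := fun _ => Fin (d + 2) → ℝ)
        (fun r => fullLift a h (e r)) (fullLift a h i))) =
      (w ⬝ᵥ projLift a i - h i) * Matrix.det (Matrix.of fun r => projLift a (e r)) := by
  set M : Matrix (Fin (d + 2)) (Fin (d + 2)) ℝ := Matrix.of (Fin.snoc
    (α := fun _ => Fin (d + 2) → ℝ) (fun r => fullLift a h (e r)) (fullLift a h i)) with hM
  let c : Fin (d + 2) → ℝ := (heightIndex d).insertNth (α := fun _ => ℝ) 1 (-w)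
  have hdot : ∀ k, (∑ j, c j • fullLift a h k j) = h k - w ⬝ᵥ projLift a k := by
    intro k
    rw [Fin.sum_univ_succAbove _ (heightIndex d)]
    simp [c, dotProduct, sub_eq_add_neg]
  have hdet := Matrix.det_updateCol_sum M (heightIndex d) c
  rw [show c (heightIndex d) = 1 by simp [c], one_smul] at hdet
  rw [← hdet, Matrix.det_succ_column _ (heightIndex d), Fin.sum_univ_castSucc,
    Finset.sum_eq_zero, zero_add]
  · have h1 : ((M.updateCol (heightIndex d) fun k => ∑ i, c i • M k i).submatrix
        (Fin.last (d + 1)).succAbove (heightIndex d).succAbove) =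
        Matrix.of fun r => projLift a (e r) := by
      ext r j
      simp [hM]
    have h2 : ((-1 : ℝ)) ^ ((Fin.last (d + 1) : Fin (d + 2)).val + (heightIndex d).val) = -1 := by
      simp only [Fin.val_last, heightIndex, Fin.val_castSucc]
      exact Odd.neg_one_pow ⟨d, by ring⟩
    rw [h1, h2, Matrix.updateCol_self]
    have h3 : (∑ j, c j • M (Fin.last (d + 1)) j) = h i - w ⬝ᵥ projLift a i := by
      rw [← hdot i]
      simp [hM]
    rw [h3]
    ring
  · intro r _
    rw [Matrix.updateCol_self]
    have h3 : (∑ j, c j • M r.castSucc j) = h (e r) - w ⬝ᵥ projLift a (e r) := by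
      rw [← hdot]
      simp [hM]
    rw [h3, hw, sub_self]
    simp

/-- Swapping two entries corrects a negative sign; for `d = 0` there is nothing to swap, but the
determinant is 1. -/
lemma exists_det_pos (hB : IsVectorBasis (projLift a) B) :
    ∃ e : Fin (d + 1) → Fin n, Finset.univ.image e = B ∧
      0 < Matrix.det (Matrix.of fun r => projLift a (e r)) := by
  classical
  let e := B.orderEmbOfFin hB.1
  have he : Finset.univ.image e = B := by
    rw [← Finset.coe_inj]
    simp [e]
  have hdet : Matrix.det (Matrix.of fun r => projLift a (e r)) ≠ 0 := by
    rw [← isUnit_iff_ne_zero, ← Matrix.isUnit_iff_isUnit_det,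
      ← Matrix.linearIndependent_rows_iff_isUnit]
    have hl : LinearIndependent ℝ (fun b : B => projLift a b) := hB.2
    exact hl.comp (fun r => ⟨e r, Finset.orderEmbOfFin_mem _ _ _⟩) fun r s hrs =>
      e.injective (congrArg Subtype.val hrs)
  rcases hdet.lt_or_gt with hneg | hpos
  · cases d with
    | zero =>
      exfalso
      have h1 : Matrix.det (Matrix.of fun r => projLift a (e r)) = 1 :=
        (Matrix.det_fin_one _).trans (homogenize_last (a (e 0)))
      rw [h1] at hneg
      linarith
    | succ d =>
      let σ : Equiv.Perm (Fin (d + 2)) := Equiv.swap 0 1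
      refine ⟨fun r => e (σ r), ?_, ?_⟩
      · rw [← he]
        ext i
        simp only [Finset.mem_image, Finset.mem_univ, true_and]
        exact (σ.surjective.exists (p := fun r => e r = i)).symm
      · have h1 := Matrix.det_permute σ (Matrix.of fun r => projLift a (e r))
        have h2 : (Matrix.of fun r => projLift a (e r)).submatrix σ id =
            Matrix.of fun r => projLift a (e (σ r)) := rfl
        rw [h2, Equiv.Perm.sign_swap (by simp)] at h1
        rw [h1]
        simpa using hneg
  · exact ⟨e, he, hpos⟩

/-- By `det_fullLift`, the determinant condition says that the lifted point of `i` lies strictly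
above the hyperplane through the lifted simplex. -/
lemma delaunayCondition_iff (hB : IsVectorBasis (projLift a) B) :
    DelaunayCondition a h Q B ↔
      ∀ i, i ∉ Q → i ∉ B → interpolant (projLift a) h B ⬝ᵥ projLift a i < h i := by
  have hw : ∀ e : Fin (d + 1) → Fin n, Finset.univ.image e = B → ∀ r,
      interpolant (projLift a) h B ⬝ᵥ projLift a (e r) = h (e r) := by
    intro e he r
    refine hB.interpolant_apply ?_
    rw [← he]
    exact Finset.mem_image_of_mem _ (Finset.mem_univ _)
  constructor
  · rintro ⟨e, he, hpos, hdel⟩ i hiQ hiB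
    have h1 := hdel i hiQ hiB
    rw [det_fullLift (hw e he)] at h1
    nlinarith
  · intro H
    obtain ⟨e, he, hpos⟩ := exists_det_pos hB
    refine ⟨e, he, hpos, fun i hiQ hiB => ?_⟩
    rw [det_fullLift (hw e he)]
    exact mul_neg_of_neg_of_pos (sub_neg.2 (H i hiQ hiB)) hpos

/-! ### Simplices -/

lemma mem_simplexOf_iff {x : Fin d → ℝ} :
    x ∈ simplexOf a B ↔ ∃ c : Fin n → ℝ, (∀ b ∈ B, 0 ≤ c b) ∧
      ∑ b ∈ B, c b • projLift a b = homogenize x := by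
  classical
  constructor
  · intro hx
    have hconv : Convex ℝ {x : Fin d → ℝ | ∃ c : Fin n → ℝ, (∀ b ∈ B, 0 ≤ c b) ∧
        ∑ b ∈ B, c b • projLift a b = homogenize x} := by
      rintro x ⟨c, hc, hcx⟩ y ⟨c', hc', hcy⟩ s t hs ht hst
      rw [sum_smul_projLift_eq_homogenize_iff] at hcx hcy
      refine ⟨fun i => s * c i + t * c' i, fun b hb =>
        add_nonneg (mul_nonneg hs (hc b hb)) (mul_nonneg ht (hc' b hb)), ?_⟩
      rw [sum_smul_projLift_eq_homogenize_iff]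
      constructor
      · simp only [add_smul, mul_smul, Finset.sum_add_distrib, ← Finset.smul_sum, hcx.1, hcy.1]
      · simp only [Finset.sum_add_distrib, ← Finset.mul_sum, hcx.2, hcy.2, mul_one, hst]
    refine convexHull_min ?_ hconv hx
    rintro _ ⟨b, hb, rfl⟩
    have hb' : b ∈ B := hb
    refine ⟨fun i => if i = b then 1 else 0, fun i _ => ?_, ?_⟩
    · dsimp only
      split_ifs <;> norm_num
    · simp [hb', projLift_eq]
  · rintro ⟨c, hc, hcx⟩
    rw [sum_smul_projLift_eq_homogenize_iff] at hcx
    rw [← hcx.1]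
    exact (convex_convexHull ℝ _).sum_mem hc hcx.2 fun b hb =>
      subset_convexHull ℝ _ ⟨b, hb, rfl⟩

lemma hullOutside_eq (Q : Finset (Fin n)) : hullOutside a Q = simplexOf a Qᶜ := by
  rw [hullOutside, simplexOf]
  congr 2
  ext i
  simp

lemma simplexOf_mono {B B' : Finset (Fin n)} (hBB : B ⊆ B') : simplexOf a B ⊆ simplexOf a B' :=
  convexHull_mono (Set.image_mono (by exact_mod_cast hBB))

lemma isClosed_simplexOf : IsClosed (simplexOf a B) :=
  ((Set.toFinite _).isCompact_convexHull ℝ).isClosed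

lemma affineSpan_image_eq_top_iff {S : Finset (Fin n)} :
    affineSpan ℝ (a '' S) = ⊤ ↔ IsSpanningIndex (projLift a) S := by
  classical
  constructor
  · intro hS w hw
    let A : AffineSubspace ℝ (Fin d → ℝ) :=
      { carrier := {x | w ⬝ᵥ homogenize x = 0}
        smul_vsub_vadd_mem' := by
          intro c p q r hp hq hr
          simp only [Set.mem_ofPred_eq, dotProduct_homogenize] at *
          rw [vsub_eq_sub, vadd_eq_add, dotProduct_add, dotProduct_smul, dotProduct_sub,
            smul_eq_mul]
          linear_combination c * hp - c * hq + hr }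
    have hA : A = ⊤ := by
      rw [eq_top_iff, ← hS, affineSpan_le]
      rintro _ ⟨i, hi, rfl⟩
      exact hw i hi
    have hall : ∀ x, w ⬝ᵥ homogenize x = 0 := fun x => by
      have : x ∈ A := by rw [hA]; trivial
      exact this
    have h0 : w (Fin.last d) = 0 := by
      have := hall 0
      rwa [dotProduct_homogenize, dotProduct_zero, zero_add] at this
    ext j
    refine Fin.lastCases h0 (fun j => ?_) j
    have := hall (Pi.single j 1)
    rw [dotProduct_homogenize, h0] at this
    simpa using this
  · intro hS
    obtain ⟨B, hBS, hB⟩ := hS.exists_basis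
    have hB' := isSimplexIndex_iff.2 hB
    have htop : affineSpan ℝ (Set.range fun b : B => a b) = ⊤ :=
      hB'.2.affineSpan_eq_top_iff_card_eq_finrank_add_one.2 (by simpa using hB'.1)
    rw [eq_top_iff, ← htop]
    refine affineSpan_mono ℝ ?_
    rintro _ ⟨b, rfl⟩
    exact ⟨b, hBS b.2, rfl⟩

lemma interior_simplexOf_nonempty_iff {S : Finset (Fin n)} :
    (interior (simplexOf a S)).Nonempty ↔ IsSpanningIndex (projLift a) S := by
  rw [simplexOf, interior_convexHull_nonempty_iff_affineSpan_eq_top, affineSpan_image_eq_top_iff]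

lemma IsSpanningIndex.le_card {m : ℕ} {v : Fin n → Fin m → ℝ} {S : Finset (Fin n)}
    (hS : IsSpanningIndex v S) : m ≤ S.card := by
  obtain ⟨B, hBS, hB⟩ := hS.exists_basis
  rw [← hB.1]
  exact Finset.card_le_card hBS

lemma IsVectorBasis.closure_interior_simplexOf (hB : IsVectorBasis (projLift a) B) :
    closure (interior (simplexOf a B)) = simplexOf a B := by
  rw [simplexOf, (convex_convexHull ℝ _).closure_interior_eq_closure_of_nonempty_interior
    (interior_simplexOf_nonempty_iff.2 hB.isSpanningIndex)]
  exact isClosed_simplexOf.closure_eq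

end

/-! ### Weighted Delaunay triangulations -/

/-- The simplices of the weighted Delaunay triangulation of the points with index outside `Q`. -/
def delaunaySimplices {d n : ℕ} (a : Fin n → Fin d → ℝ) (h : Fin n → ℝ) (Q : Finset (Fin n)) :
    Set (Finset (Fin n)) :=
  {B | IsVectorBasis (projLift a) B ∧ Disjoint B Q ∧
    aboveSet (projLift a) h (interpolant (projLift a) h B) ⊆ Q}

section
variable {d n : ℕ} {a : Fin n → Fin d → ℝ} {h : Fin n → ℝ} {B B' Q : Finset (Fin n)}

lemma interpolant_le_of_mem_delaunaySimplices (hB : B ∈ delaunaySimplices a h Q) {i : Fin n}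
    (hi : i ∉ Q) : interpolant (projLift a) h B ⬝ᵥ projLift a i ≤ h i := by
  by_contra hcon
  exact hi (hB.2.2 (mem_aboveSet.2 (not_le.1 hcon)))

lemma interpolant_lt_of_mem_delaunaySimplices (hgen : IsGenericValue (projLift a) h)
    (hB : B ∈ delaunaySimplices a h Q) {i : Fin n} (hi : i ∉ Q) (hiB : i ∉ B) :
    interpolant (projLift a) h B ⬝ᵥ projLift a i < h i := by
  refine lt_of_le_of_ne (interpolant_le_of_mem_delaunaySimplices hB hi) fun heq => hiB ?_
  rw [← hB.1.tightSet_interpolant hgen]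
  exact mem_tightSet.2 heq

lemma mem_delaunaySimplices_iff (hgen : IsGenericValue (projLift a) h) :
    B ∈ delaunaySimplices a h Q ↔
      IsVectorBasis (projLift a) B ∧ Disjoint B Q ∧ DelaunayCondition a h Q B := by
  constructor
  · intro hB
    exact ⟨hB.1, hB.2.1, (delaunayCondition_iff hB.1).2 fun i hiQ hiB =>
      interpolant_lt_of_mem_delaunaySimplices hgen hB hiQ hiB⟩
  · rintro ⟨hB, hd, hdel⟩
    rw [delaunayCondition_iff hB] at hdel
    refine ⟨hB, hd, fun i hi => by_contra fun hiQ => ?_⟩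
    rw [mem_aboveSet] at hi
    by_cases hiB : i ∈ B
    · rw [hB.interpolant_apply hiB] at hi
      exact lt_irrefl _ hi
    · exact lt_asymm hi (hdel i hiQ hiB)

lemma interpolant_dotProduct_eq (hB : IsVectorBasis (projLift a) B) {c : Fin n → ℝ}
    {z : Fin (d + 1) → ℝ} (hc : ∑ b ∈ B, c b • projLift a b = z) :
    interpolant (projLift a) h B ⬝ᵥ z = ∑ b ∈ B, c b * h b := by
  rw [← hc, dotProduct_sum]
  exact Finset.sum_congr rfl fun b hb => by
    rw [dotProduct_smul, hB.interpolant_apply hb, smul_eq_mul]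

/-- On its own simplex the functional of `B` interpolates the heights of the vertices, and the
functional of `B'` stays at or below all heights outside `Q`. -/
lemma interpolant_homogenize_le (hB : B ∈ delaunaySimplices a h Q)
    (hB' : B' ∈ delaunaySimplices a h Q) {x : Fin d → ℝ} (hx : x ∈ simplexOf a B) :
    interpolant (projLift a) h B' ⬝ᵥ homogenize x ≤
      interpolant (projLift a) h B ⬝ᵥ homogenize x := by
  obtain ⟨c, hc, hcx⟩ := mem_simplexOf_iff.1 hx
  rw [interpolant_dotProduct_eq hB.1 hcx, ← hcx, dotProduct_sum]
  refine Finset.sum_le_sum fun b hb => ?_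
  rw [dotProduct_smul, smul_eq_mul]
  exact mul_le_mul_of_nonneg_left (interpolant_le_of_mem_delaunaySimplices hB'
    (Finset.disjoint_left.1 hB.2.1 hb)) (hc b hb)

/-- At a common point both functionals agree, so the termwise inequalities between them are
equalities. A vertex of `B` outside `B'` has a strict one, hence weight 0. -/
lemma simplexOf_inter (hgen : IsGenericValue (projLift a) h) (hB : B ∈ delaunaySimplices a h Q)
    (hB' : B' ∈ delaunaySimplices a h Q) :
    simplexOf a B ∩ simplexOf a B' = simplexOf a (B ∩ B') := by
  apply Set.Subset.antisymm
  · rintro x ⟨hx, hx'⟩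
    have heq := le_antisymm (interpolant_homogenize_le hB' hB hx')
      (interpolant_homogenize_le hB hB' hx)
    obtain ⟨c, hc, hcx⟩ := mem_simplexOf_iff.1 hx
    rw [interpolant_dotProduct_eq hB.1 hcx] at heq
    rw [← hcx, dotProduct_sum] at heq
    simp only [dotProduct_smul, smul_eq_mul] at heq
    rw [eq_comm, Finset.sum_eq_sum_iff_of_le fun b hb => mul_le_mul_of_nonneg_left
      (interpolant_le_of_mem_delaunaySimplices hB' (Finset.disjoint_left.1 hB.2.1 hb))
      (hc b hb)] at heq
    refine mem_simplexOf_iff.2 ⟨c, fun b hb => hc b (Finset.mem_inter.1 hb).1, ?_⟩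
    rw [← hcx]
    refine Finset.sum_subset Finset.inter_subset_left fun b hb hbn => ?_
    have hbB' : b ∉ B' := fun hb' => hbn (Finset.mem_inter.2 ⟨hb, hb'⟩)
    have h1 := interpolant_lt_of_mem_delaunaySimplices hgen hB'
      (Finset.disjoint_left.1 hB.2.1 hb) hbB'
    have h2 : c b = 0 := by
      by_contra h0
      exact h1.ne (mul_left_cancel₀ h0 (heq b hb))
    rw [h2, zero_smul]
  · exact Set.subset_inter (simplexOf_mono Finset.inter_subset_left)
      (simplexOf_mono Finset.inter_subset_right)

/-- Otherwise `B ∩ B'` would span, have `d + 1` elements, and equal both `B` and `B'`. -/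
lemma disjoint_interior_simplexOf (hgen : IsGenericValue (projLift a) h)
    (hB : B ∈ delaunaySimplices a h Q) (hB' : B' ∈ delaunaySimplices a h Q) (hne : B ≠ B') :
    Disjoint (interior (simplexOf a B)) (simplexOf a B') := by
  rw [← hB'.1.closure_interior_simplexOf]
  refine Disjoint.closure_right ?_ isOpen_interior
  rw [Set.disjoint_iff_inter_eq_empty, ← interior_inter, simplexOf_inter hgen hB hB',
    ← Set.not_nonempty_iff_eq_empty, interior_simplexOf_nonempty_iff]
  intro hsp
  have h1 := hsp.le_card
  have h2 : B ∩ B' = B := Finset.eq_of_subset_of_card_le Finset.inter_subset_left (by rwa [hB.1.1])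
  have h3 : B ∩ B' = B' :=
    Finset.eq_of_subset_of_card_le Finset.inter_subset_right (by rwa [hB'.1.1])
  exact hne (h2.symm.trans h3)

/-- A Delaunay simplex covered by Delaunay simplices is one of them. -/
lemma mem_of_simplexOf_subset (hgen : IsGenericValue (projLift a) h)
    (hB : B ∈ delaunaySimplices a h Q) {𝒜 : Set (Finset (Fin n))}
    (h𝒜 : 𝒜 ⊆ delaunaySimplices a h Q) (hsub : simplexOf a B ⊆ ⋃ C ∈ 𝒜, simplexOf a C) :
    B ∈ 𝒜 := by
  obtain ⟨x, hx⟩ := interior_simplexOf_nonempty_iff.2 hB.1.isSpanningIndex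
  have hx' := hsub (interior_subset hx)
  simp only [Set.mem_iUnion] at hx'
  obtain ⟨C, hC, hxC⟩ := hx'
  by_cases hBC : B = C
  · rwa [hBC]
  · exact absurd hxC
      (Set.disjoint_left.1 (disjoint_interior_simplexOf hgen hB (h𝒜 hC) hBC) hx)

lemma simplexOf_subset_hullOutside (hB : Disjoint B Q) : simplexOf a B ⊆ hullOutside a Q := by
  rw [hullOutside_eq]
  exact simplexOf_mono fun i hi => Finset.mem_compl.2 (Finset.disjoint_left.1 hB hi)

/-- Obtained from the covering of the zonotope. The point `(1/2) • homogenize x` lies in a tile, and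
since its last coordinate is less than 1, that tile has no index above outside `Q`; so its basis is
Delaunay and contains `x`. -/
lemma iUnion_delaunaySimplices (hgen : IsGenericValue (projLift a) h)
    (hQ : (interior (hullOutside a Q)).Nonempty) :
    ⋃ B ∈ delaunaySimplices a h Q, simplexOf a B = hullOutside a Q := by
  apply Set.Subset.antisymm
  · exact Set.iUnion₂_subset fun B hB => simplexOf_subset_hullOutside hB.2.1
  · intro x hx
    rw [hullOutside_eq] at hx hQ
    obtain ⟨c, hc, hcx⟩ := mem_simplexOf_iff.1 hx
    have hc1 := ((sum_smul_projLift_eq_homogenize_iff _ _ _).1 hcx).2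
    have hα : ∀ i ∈ Qᶜ, c i / 2 ∈ Set.Icc (0 : ℝ) 1 := by
      intro i hi
      have h1 := Finset.single_le_sum hc hi
      have h0 := hc i hi
      constructor <;> linarith
    obtain ⟨B, hBQ, hB, β, hβ, hz⟩ := exists_basis_of_mem hgen
      (interior_simplexOf_nonempty_iff.1 hQ) hα rfl
    have hsum : ∑ i ∈ Qᶜ, (c i / 2) • projLift a i = (1 / 2 : ℝ) • homogenize x := by
      rw [← hcx, Finset.smul_sum]
      refine Finset.sum_congr rfl fun i _ => ?_
      rw [smul_smul]
      congr 1
      ring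
    rw [hsum] at hz
    have hlast := congrFun hz (Fin.last d)
    simp only [Pi.smul_apply, Pi.add_apply, Finset.sum_apply, projLift_eq, homogenize_last,
      smul_eq_mul, mul_one, Finset.sum_const, nsmul_eq_mul] at hlast
    have hβ0 : 0 ≤ ∑ i ∈ B, β i := Finset.sum_nonneg fun b hb => (hβ b hb).1
    have hempty : aboveSet (projLift a) h (interpolant (projLift a) h B) ∩ Qᶜ = ∅ := by
      rw [← Finset.card_eq_zero]
      by_contra hne
      have : (1 : ℝ) ≤ ((aboveSet (projLift a) h (interpolant (projLift a) h B) ∩ Qᶜ).card : ℝ) := by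
        exact_mod_cast Nat.one_le_iff_ne_zero.2 hne
      linarith
    rw [hempty, Finset.sum_empty, zero_add] at hz
    have hBmem : B ∈ delaunaySimplices a h Q := by
      refine ⟨hB, ?_, fun i hi => by_contra fun hiQ => ?_⟩
      · rw [Finset.disjoint_left]
        exact fun i hi => Finset.mem_compl.1 (hBQ hi)
      · have : i ∈ (∅ : Finset (Fin n)) := by
          rw [← hempty]
          exact Finset.mem_inter.2 ⟨hi, Finset.mem_compl.2 hiQ⟩
        simp at this
    refine Set.mem_iUnion₂.2 ⟨B, hBmem, mem_simplexOf_iff.2 ⟨fun b => 2 * β b, fun b hb =>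
      mul_nonneg zero_le_two (hβ b hb).1, ?_⟩⟩
    simp only [mul_smul, ← Finset.smul_sum, ← hz]
    rw [smul_smul]
    norm_num

/-- Any set of Delaunay simplices is a weighted Delaunay triangulation of its union. -/
lemma isWeightedDelaunay_of_subset (hgen : IsGenericValue (projLift a) h)
    {𝒜 : Set (Finset (Fin n))} (h𝒜 : 𝒜 ⊆ delaunaySimplices a h Q) {R : Set (Fin d → ℝ)}
    (hR : ⋃ B ∈ 𝒜, simplexOf a B = R) : IsWeightedDelaunay a h Q R 𝒜 where
  triangulation :=
    { simplex := fun B hB => isSimplexIndex_iff.2 (h𝒜 hB).1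
      injOn := by
        intro B hB B' hB' heq
        have : B ∈ ({B'} : Set (Finset (Fin n))) := mem_of_simplexOf_subset hgen (h𝒜 hB)
          (Set.singleton_subset_iff.2 (h𝒜 hB')) (by simpa using heq.subset)
        simpa using this
      cover := hR
      inter := fun B hB B' hB' => ⟨B ∩ B', Finset.inter_subset_left, B ∩ B',
        Finset.inter_subset_right, simplexOf_inter hgen (h𝒜 hB) (h𝒜 hB'),
        simplexOf_inter hgen (h𝒜 hB) (h𝒜 hB')⟩ }
  outside := fun B hB => (h𝒜 hB).2.1
  delaunay := fun B hB => ((mem_delaunaySimplices_iff hgen).1 (h𝒜 hB)).2.2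

lemma eq_delaunaySimplices (hgen : IsGenericValue (projLift a) h) {T : Set (Finset (Fin n))}
    (hT : IsWeightedDelaunay a h Q (hullOutside a Q) T) : T = delaunaySimplices a h Q := by
  have hsub : T ⊆ delaunaySimplices a h Q := fun B hB => (mem_delaunaySimplices_iff hgen).2
    ⟨isSimplexIndex_iff.1 (hT.triangulation.simplex B hB), hT.outside B hB, hT.delaunay B hB⟩
  refine hsub.antisymm fun B hB => mem_of_simplexOf_subset hgen hB hsub ?_
  rw [hT.triangulation.cover]
  exact simplexOf_subset_hullOutside hB.2.1

lemma existsUnique_isWeightedDelaunay (hgen : IsGenericValue (projLift a) h)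
    (hQ : (interior (hullOutside a Q)).Nonempty) :
    ∃! T : Set (Finset (Fin n)), IsWeightedDelaunay a h Q (hullOutside a Q) T :=
  ⟨delaunaySimplices a h Q,
    isWeightedDelaunay_of_subset hgen Set.Subset.rfl (iUnion_delaunaySimplices hgen hQ),
    fun _ hT => eq_delaunaySimplices hgen hT⟩

/-- The part of the hull that is not covered by some of the Delaunay simplices is, up to
regularization, the union of the other ones. -/
lemma closure_interior_hullOutside_diff (hgen : IsGenericValue (projLift a) h)
    (hQ : (interior (hullOutside a Q)).Nonempty) {𝒜 : Set (Finset (Fin n))}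
    (h𝒜 : 𝒜 ⊆ delaunaySimplices a h Q) :
    closure (interior (hullOutside a Q \ ⋃ B ∈ delaunaySimplices a h Q \ 𝒜, simplexOf a B)) =
      ⋃ B ∈ 𝒜, simplexOf a B := by
  apply Set.Subset.antisymm
  · refine closure_minimal (interior_subset.trans ?_)
      ((Set.toFinite 𝒜).isClosed_biUnion fun _ _ => isClosed_simplexOf)
    rintro x ⟨hx, hxn⟩
    rw [← iUnion_delaunaySimplices hgen hQ] at hx
    obtain ⟨B, hB, hxB⟩ := Set.mem_iUnion₂.1 hx
    by_cases hBA : B ∈ 𝒜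
    · exact Set.mem_iUnion₂.2 ⟨B, hBA, hxB⟩
    · exact absurd (Set.mem_iUnion₂.2 ⟨B, ⟨hB, hBA⟩, hxB⟩) hxn
  · refine Set.iUnion₂_subset fun B hB => ?_
    rw [← (h𝒜 hB).1.closure_interior_simplexOf]
    refine closure_mono (interior_maximal ?_ isOpen_interior)
    intro x hx
    refine ⟨simplexOf_subset_hullOutside (h𝒜 hB).2.1 (interior_subset hx), fun hxn => ?_⟩
    obtain ⟨C, hC, hxC⟩ := Set.mem_iUnion₂.1 hxn
    have hne : B ≠ C := fun heq => hC.2 (heq ▸ hB)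
    exact Set.disjoint_left.1 (disjoint_interior_simplexOf hgen (h𝒜 hB) hC.1 hne) hx hxC

/-! ### Tiles and the lifted zonotope -/

/-- Two basic tiles meet in a common face. -/
lemma basicTiles_inter {m : ℕ} {v : Fin n → Fin m → ℝ} (hgen : IsGenericValue v h)
    {t t' : TileLabel n} (ht : t ∈ basicTiles v h) (ht' : t' ∈ basicTiles v h) :
    tileSet v t ∩ tileSet v t' = ∅ ∨
    ∃ f : TileLabel n, IsTileFace f t ∧ IsTileFace f t' ∧
      tileSet v t ∩ tileSet v t' = tileSet v f := by
  classical
  have hd := disjoint_of_mem_basicTiles hgen ht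
  have hd' := disjoint_of_mem_basicTiles hgen ht'
  obtain ⟨hB, w, h1, h2⟩ := (mem_basicTiles_iff hgen).1 ht
  obtain ⟨hB', w', h1', h2'⟩ := (mem_basicTiles_iff hgen).1 ht'
  have hco := tileCoeffs_eq (t := t) (x := fun i => w ⬝ᵥ v i - h i)
    (fun i => by rw [h1, mem_aboveSet, sub_pos]) (fun i => by rw [h2, mem_tightSet, sub_eq_zero])
  have hco' := tileCoeffs_eq (t := t') (x := fun i => w' ⬝ᵥ v i - h i)
    (fun i => by rw [h1', mem_aboveSet, sub_pos])
    (fun i => by rw [h2', mem_tightSet, sub_eq_zero])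
  -- For a fixed point `∑ α i • v i`, maximizing this value means minimizing the height `∑ α i * h
  -- i`, a criterion that no longer depends on the functional `u`.
  have hval : ∀ (u : Fin m → ℝ) (α : Fin n → ℝ),
      ∑ i, α i * (u ⬝ᵥ v i - h i) = u ⬝ᵥ (∑ i, α i • v i) - ∑ i, α i * h i := by
    intro u α
    simp only [mul_sub, Finset.sum_sub_distrib, dotProduct_sum, dotProduct_smul, smul_eq_mul]
  -- a point of both tiles has the same coefficients in both of them
  have hcommon : ∀ z ∈ tileSet v t ∩ tileSet v t',
      ∃ α ∈ tileCoeffs t ∩ tileCoeffs t', ∑ i, α i • v i = z := by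
    rintro z ⟨hz, hz'⟩
    obtain ⟨α, hα, hαz⟩ := (mem_tileSet_iff_of_disjoint hd).1 hz
    obtain ⟨α', hα', hαz'⟩ := (mem_tileSet_iff_of_disjoint hd').1 hz'
    refine ⟨α, ⟨hα, ?_⟩, hαz⟩
    rw [hco] at hα
    rw [hco'] at hα' ⊢
    refine ⟨hα.1, le_antisymm (sum_mul_le_sum_max hα.1) ?_⟩
    have e1 := sum_mul_le_sum_max (x := fun i => w ⬝ᵥ v i - h i) hα'.1
    rw [← hα.2, hval, hval, hαz, hαz'] at e1
    rw [← hα'.2, hval, hval, hαz, hαz']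
    linarith
  -- The tiles are compatible if no index is fixed to 1 in one and to 0 in the other. Otherwise they
  -- share no coefficient vector, hence no point.
  by_cases hcons : t.1 ⊆ t'.1 ∪ t'.2 ∧ t'.1 ⊆ t.1 ∪ t.2
  · right
    refine ⟨(t.1 ∪ t'.1, t.2 ∩ t'.2), ⟨Finset.inter_subset_left, Finset.subset_union_left,
      Finset.union_subset Finset.subset_union_left hcons.2, ?_⟩,
      ⟨Finset.inter_subset_right, Finset.subset_union_right,
      Finset.union_subset hcons.1 Finset.subset_union_left, ?_⟩, ?_⟩
    all_goals have hdf : Disjoint (t.1 ∪ t'.1) (t.2 ∩ t'.2) :=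
      Finset.disjoint_union_left.2 ⟨hd.mono_right Finset.inter_subset_left,
        hd'.mono_right Finset.inter_subset_right⟩
    · exact hdf
    · exact hdf
    · have hfc : tileCoeffs (t.1 ∪ t'.1, t.2 ∩ t'.2) = tileCoeffs t ∩ tileCoeffs t' := by
        ext α
        constructor
        · rintro ⟨h01, hone, hzero⟩
          refine ⟨⟨h01, fun i hi => hone i (Finset.mem_union_left _ hi), fun i hi hi' => ?_⟩,
            ⟨h01, fun i hi => hone i (Finset.mem_union_right _ hi), fun i hi hi' => ?_⟩⟩
          · refine hzero i (fun hmem => ?_) fun hmem => hi' (Finset.mem_inter.1 hmem).1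
            rcases Finset.mem_union.1 hmem with hm | hm
            · exact hi hm
            · rcases Finset.mem_union.1 (hcons.2 hm) with hm | hm
              · exact hi hm
              · exact hi' hm
          · refine hzero i (fun hmem => ?_) fun hmem => hi' (Finset.mem_inter.1 hmem).2
            rcases Finset.mem_union.1 hmem with hm | hm
            · rcases Finset.mem_union.1 (hcons.1 hm) with hm | hm
              · exact hi hm
              · exact hi' hm
            · exact hi hm
        · rintro ⟨⟨h01, hone, hzero⟩, ⟨-, hone', hzero'⟩⟩
          refine ⟨h01, fun i hi => ?_, fun i hi hi' => ?_⟩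
          · rcases Finset.mem_union.1 hi with hm | hm
            · exact hone i hm
            · exact hone' i hm
          · rw [Finset.mem_union, not_or] at hi
            by_cases hit : i ∈ t.2
            · exact hzero' i hi.2 fun hit' => hi' (Finset.mem_inter.2 ⟨hit, hit'⟩)
            · exact hzero i hi.1 hit
      ext z
      rw [mem_tileSet_iff_of_disjoint hdf, hfc]
      refine ⟨hcommon z, ?_⟩
      rintro ⟨α, ⟨hα, hα'⟩, rfl⟩
      exact ⟨(mem_tileSet_iff_of_disjoint hd).2 ⟨α, hα, rfl⟩,
        (mem_tileSet_iff_of_disjoint hd').2 ⟨α, hα', rfl⟩⟩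
  · left
    rw [← Set.not_nonempty_iff_eq_empty]
    rintro ⟨z, hz⟩
    obtain ⟨α, ⟨⟨-, hone, hzero⟩, ⟨-, hone', hzero'⟩⟩, -⟩ := hcommon z hz
    apply hcons
    constructor
    · intro i hi
      by_contra hcon
      rw [Finset.mem_union, not_or] at hcon
      have := hone i hi
      rw [hzero' i hcon.1 hcon.2] at this
      norm_num at this
    · intro i hi
      by_contra hcon
      rw [Finset.mem_union, not_or] at hcon
      have := hone' i hi
      rw [hzero i hcon.1 hcon.2] at this
      norm_num at this

lemma iUnion_basicTiles {m : ℕ} {v : Fin n → Fin m → ℝ} (hgen : IsGenericValue v h)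
    (hspan : IsSpanningIndex v Finset.univ) :
    ⋃ t ∈ basicTiles v h, tileSet v t = zonotope v := by
  apply Set.Subset.antisymm
  · exact Set.iUnion₂_subset fun t ht =>
      tileSet_subset_zonotope (disjoint_of_mem_basicTiles hgen ht)
  · intro z hz
    obtain ⟨α, hα, hαz⟩ := mem_zonotope_iff.1 hz
    obtain ⟨B, -, hB, β, hβ, hzβ⟩ := exists_basis_of_mem hgen hspan (fun i _ => hα i) hαz
    refine Set.mem_iUnion₂.2 ⟨(aboveSet v h (interpolant v h B), B), ⟨hB, rfl⟩, ?_⟩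
    rw [Finset.inter_univ] at hzβ
    exact mem_tileSet_iff.2 ⟨β, hβ, hzβ.symm⟩

lemma isFineZonotopalTiling_basicTiles (hgen : IsGenericValue (projLift a) h)
    (hspan : IsSpanningIndex (projLift a) Finset.univ) :
    IsFineZonotopalTiling a (basicTiles (projLift a) h) where
  disjoint := fun _ ht => disjoint_of_mem_basicTiles hgen ht
  simplex := fun _ ht => isSimplexIndex_iff.2 ht.1
  cover := iUnion_basicTiles hgen hspan
  inter := fun _ ht _ ht' => basicTiles_inter hgen ht ht'

end

/-! ### Facets of the lifted zonotope -/

section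
variable {d n : ℕ} {a : Fin n → Fin d → ℝ} {h : Fin n → ℝ}

lemma image_dropHeight_tileSet (t : TileLabel n) :
    dropHeight '' tileSet (fullLift a h) t = tileSet (projLift a) t := by
  have hdrop : ∀ α : Fin n → ℝ, dropHeight (∑ i ∈ t.1, fullLift a h i +
      ∑ i ∈ t.2, α i • fullLift a h i) = ∑ i ∈ t.1, projLift a i + ∑ i ∈ t.2, α i • projLift a i := by
    intro α
    ext j
    simp [dropHeight, Fin.removeNth, Finset.sum_apply]
  ext z
  simp only [Set.mem_image, mem_tileSet_iff]
  constructor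
  · rintro ⟨-, ⟨α, hα, rfl⟩, rfl⟩
    exact ⟨α, hα, (hdrop α).symm⟩
  · rintro ⟨α, hα, rfl⟩
    exact ⟨_, ⟨α, hα, rfl⟩, hdrop α⟩

lemma isSpanningIndex_iff_finrank {m : ℕ} {v : Fin n → Fin m → ℝ} {S : Finset (Fin n)} :
    IsSpanningIndex v S ↔ Module.finrank ℝ (Submodule.span ℝ (v '' S)) = m := by
  constructor
  · intro hS
    obtain ⟨B, hBS, hB⟩ := hS.exists_basis
    have : Submodule.span ℝ (v '' S) = ⊤ := by
      rw [eq_top_iff, ← hB.span_eq_top]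
      exact Submodule.span_mono (Set.image_mono (by exact_mod_cast hBS))
    rw [this]
    simp
  · intro hS w hw
    have htop : Submodule.span ℝ (v '' S) = ⊤ := Submodule.eq_top_of_finrank_eq (by simpa using hS)
    have hmem : w ∈ Submodule.span ℝ (v '' S) := by rw [htop]; trivial
    obtain ⟨c, hc⟩ := exists_sum_eq_of_mem_span hmem
    have : w ⬝ᵥ ∑ b ∈ S, c b • v b = 0 := by
      rw [dotProduct_sum]
      exact Finset.sum_eq_zero fun b hb => by rw [dotProduct_smul, hw b hb, smul_zero]
    rw [hc] at this
    exact dotProduct_self_eq_zero.1 this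

/-- Lifting vectors to a non-vertical hyperplane does not change the dimension of their span. -/
lemma finrank_span_fullLift {S : Finset (Fin n)} {w : Fin (d + 1) → ℝ}
    (hw : ∀ i ∈ S, w ⬝ᵥ projLift a i = h i) :
    Module.finrank ℝ (Submodule.span ℝ (fullLift a h '' S)) =
      Module.finrank ℝ (Submodule.span ℝ (projLift a '' S)) := by
  let G : (Fin (d + 1) → ℝ) →ₗ[ℝ] (Fin (d + 2) → ℝ) :=
    { toFun := fun z => (heightIndex d).insertNth (α := fun _ => ℝ) (w ⬝ᵥ z) z
      map_add' := by
        intro x y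
        ext j
        refine Fin.succAboveCases (heightIndex d) ?_ (fun j => ?_) j
        · simp [dotProduct_add]
        · simp
      map_smul' := by
        intro c x
        ext j
        refine Fin.succAboveCases (heightIndex d) ?_ (fun j => ?_) j
        · simp [dotProduct_smul]
        · simp }
  have hG : Function.Injective G := by
    intro x y hxy
    ext j
    have := congrFun hxy ((heightIndex d).succAbove j)
    simpa [G] using this
  have himg : fullLift a h '' S = G '' (projLift a '' S) := by
    rw [Set.image_image]
    refine Set.image_congr fun i hi => ?_
    ext j
    refine Fin.succAboveCases (heightIndex d) ?_ (fun j => ?_) j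
    · simp [G, hw i hi]
    · simp [G]
  rw [himg, Submodule.span_image]
  exact (Submodule.equivMapOfInjective G hG _).finrank_eq.symm

/-- The facets on one side of the lifted zonotope, with heights scaled by `σ`, are the lifted
basic tiles. -/
lemma facet_iff (hgen : IsGenericValue (projLift a) h) {σ : ℝ} (hσ : σ ≠ 0)
    {F : Set (Fin (d + 2) → ℝ)} :
    ((∃ N : Fin (d + 2) → ℝ, N (heightIndex d) * σ < 0 ∧
        F = faceInDirection (zonotope (fullLift a (σ • h))) N) ∧
      Module.finrank ℝ (vectorSpan ℝ F) = d + 1) ↔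
    ∃ t ∈ basicTiles (projLift a) h, F = tileSet (fullLift a (σ • h)) t := by
  have hfin : ∀ w : Fin (d + 1) → ℝ, Module.finrank ℝ (Submodule.span ℝ
      (fullLift a (σ • h) '' (tightSet (projLift a) h w : Set (Fin n)))) = d + 1 ↔
      IsSpanningIndex (projLift a) (tightSet (projLift a) h w) := by
    intro w
    rw [isSpanningIndex_iff_finrank, finrank_span_fullLift (w := σ • w) fun i hi => by
      rw [smul_dotProduct, mem_tightSet.1 hi, Pi.smul_apply]]
  have hface : ∀ (N : Fin (d + 2) → ℝ) (w : Fin (d + 1) → ℝ), N (heightIndex d) * σ < 0 →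
      dropHeight N = (-(N (heightIndex d) * σ)) • w →
      faceInDirection (zonotope (fullLift a (σ • h))) N = tileSet (fullLift a (σ • h))
        (aboveSet (projLift a) h w, tightSet (projLift a) h w) := by
    intro N w hN hw
    have hdot : ∀ i, N ⬝ᵥ fullLift a (σ • h) i =
        (-(N (heightIndex d) * σ)) * (w ⬝ᵥ projLift a i - h i) := by
      intro i
      rw [dotProduct_fullLift, hw, smul_dotProduct, Pi.smul_apply, smul_eq_mul, smul_eq_mul]
      ring
    have hc : 0 < -(N (heightIndex d) * σ) := neg_pos.2 hN
    refine faceInDirection_zonotope (fun i => ?_) fun i => ?_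
    · rw [mem_aboveSet, hdot, mul_pos_iff_of_pos_left hc, sub_pos]
    · rw [mem_tightSet, hdot, mul_eq_zero, or_iff_right hc.ne', sub_eq_zero]
  constructor
  · rintro ⟨⟨N, hN, rfl⟩, hdim⟩
    have hc : -(N (heightIndex d) * σ) ≠ 0 := (neg_pos.2 hN).ne'
    set w := (-(N (heightIndex d) * σ))⁻¹ • dropHeight N with hw
    have hF := hface N w hN (by rw [hw, smul_smul, mul_inv_cancel₀ hc, one_smul])
    rw [hF, vectorSpan_tileSet, hfin] at hdim
    -- A spanning tight set contains a basis, and by genericity is equal to it.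
    obtain ⟨B, hBS, hB⟩ := hdim.exists_basis
    have htight := hB.tightSet_eq hgen fun b hb => mem_tightSet.1 (hBS hb)
    exact ⟨_, (mem_basicTiles_iff hgen).2 ⟨by rw [htight]; exact hB, w, rfl, rfl⟩, hF⟩
  · rintro ⟨t, ht, rfl⟩
    obtain ⟨hB, w, h1, h2⟩ := (mem_basicTiles_iff hgen).1 ht
    have ht' : t = (aboveSet (projLift a) h w, tightSet (projLift a) h w) := Prod.ext h1 h2
    -- The height entry is chosen so that the positive factor `-(N (heightIndex d) * σ)` is 1.
    refine ⟨⟨(heightIndex d).insertNth (α := fun _ => ℝ) (-σ⁻¹) w, ?_, ?_⟩, ?_⟩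
    · simp [hσ]
    · rw [ht', hface _ w (by simp [hσ])]
      ext j
      simp [dropHeight, Fin.removeNth, hσ]
    · rw [vectorSpan_tileSet, h2, hfin, ← h2]
      exact hB.isSpanningIndex

lemma isLowerFacet_iff (hgen : IsGenericValue (projLift a) h) {F : Set (Fin (d + 2) → ℝ)} :
    IsLowerFacet (zonotope (fullLift a h)) F ↔
      ∃ t ∈ basicTiles (projLift a) h, F = tileSet (fullLift a h) t := by
  rw [IsLowerFacet]
  have := facet_iff hgen one_ne_zero (F := F)
  simpa only [one_smul, mul_one] using this

lemma isUpperFacet_iff (hgen : IsGenericValue (projLift a) h) {F : Set (Fin (d + 2) → ℝ)} :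
    IsUpperFacet (zonotope (fullLift a (-h))) F ↔
      ∃ t ∈ basicTiles (projLift a) h, F = tileSet (fullLift a (-h)) t := by
  rw [IsUpperFacet]
  have := facet_iff hgen (neg_ne_zero.2 one_ne_zero) (F := F)
  simpa only [neg_smul, one_smul, mul_neg, mul_one, neg_lt_zero] using this

/-- `isLowerFacet_iff` identifies facets only as sets; `label_eq_of_tileSet_eq` recovers the label,
even for repeated vectors. -/
lemma lowerHullLabels_eq (hgen : IsGenericValue (projLift a) h) :
    lowerHullLabels a h = basicTiles (projLift a) h := by
  ext t
  constructor
  · rintro ⟨hd, hcard, hF⟩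
    obtain ⟨t', ht', heq⟩ := (isLowerFacet_iff hgen).1 hF
    obtain ⟨hB, w, h1, h2⟩ := (mem_basicTiles_iff hgen).1 ht'
    let N : Fin (d + 2) → ℝ := (heightIndex d).insertNth (α := fun _ => ℝ) (-1) w
    have hN : ∀ i, N ⬝ᵥ fullLift a h i = w ⬝ᵥ projLift a i - h i := by
      intro i
      have : dropHeight N = w := by
        ext j
        simp [N, dropHeight, Fin.removeNth]
      rw [dotProduct_fullLift, this]
      simp only [N, Fin.insertNth_apply_same]
      ring
    have : t = t' := label_eq_of_tileSet_eq (u := fullLift a h) (N := N)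
      (fun i => by rw [h1, mem_aboveSet, hN, sub_pos])
      (fun i => by rw [h2, mem_tightSet, hN, sub_eq_zero]) hd (by rw [hB.1, hcard]) heq.subset
    exact this ▸ ht'
  · intro ht
    exact ⟨disjoint_of_mem_basicTiles hgen ht, ht.1.1, (isLowerFacet_iff hgen).2 ⟨t, ht, rfl⟩⟩

lemma image_tileSet_basicTiles (hgen : IsGenericValue (projLift a) h) :
    tileSet (projLift a) '' basicTiles (projLift a) h =
      {G | ∃ F, IsLowerFacet (zonotope (fullLift a h)) F ∧ G = dropHeight '' F} := by
  ext G
  constructor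
  · rintro ⟨t, ht, rfl⟩
    exact ⟨_, (isLowerFacet_iff hgen).2 ⟨t, ht, rfl⟩, (image_dropHeight_tileSet t).symm⟩
  · rintro ⟨F, hF, rfl⟩
    obtain ⟨t, ht, rfl⟩ := (isLowerFacet_iff hgen).1 hF
    exact ⟨t, ht, (image_dropHeight_tileSet t).symm⟩

/-- Negating the heights exchanges lower and upper hull without changing the projected tiles. -/
lemma isRegularTiling_basicTiles (hgen : IsGenericValue (projLift a) h) :
    IsRegularTiling a (basicTiles (projLift a) h) := by
  refine ⟨n, fullLift a (-h), ?_⟩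
  ext G
  constructor
  · rintro ⟨t, ht, rfl⟩
    exact ⟨_, (isUpperFacet_iff hgen).2 ⟨t, ht, rfl⟩, (image_dropHeight_tileSet t).symm⟩
  · rintro ⟨F, hF, rfl⟩
    obtain ⟨t, ht, rfl⟩ := (isUpperFacet_iff hgen).1 hF
    exact ⟨t, ht, (image_dropHeight_tileSet t).symm⟩

/-! ### The construction -/

lemma interior_hullOutside_nonempty {t : TileLabel n} (hgen : IsGenericValue (projLift a) h)
    (ht : t ∈ basicTiles (projLift a) h) : (interior (hullOutside a t.1)).Nonempty :=
  (interior_simplexOf_nonempty_iff.2 ht.1.isSpanningIndex).mono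
    (interior_mono (simplexOf_subset_hullOutside (disjoint_of_mem_basicTiles hgen ht).symm))

lemma mem_delaunaySimplices_of_mem_basicTiles (hgen : IsGenericValue (projLift a) h)
    {t : TileLabel n} (ht : t ∈ basicTiles (projLift a) h) : t.2 ∈ delaunaySimplices a h t.1 :=
  ⟨ht.1, (disjoint_of_mem_basicTiles hgen ht).symm, ht.2.symm.subset⟩

/-- A Delaunay simplex for the points outside `Q` has above set contained in `Q`. If the inclusion
is strict, its tile has smaller order and its simplex is removed as part of some `E^(r)(Q)`; if not,
it survives. When the hull has no interior, both sides are empty. -/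
lemma linkRegion_basicTiles (hgen : IsGenericValue (projLift a) h) (Q : Finset (Fin n)) :
    linkRegion a {t ∈ basicTiles (projLift a) h | t.1.card < Q.card} Q =
      ⋃ B ∈ {B | (Q, B) ∈ basicTiles (projLift a) h}, simplexOf a B := by
  by_cases hQ : (interior (hullOutside a Q)).Nonempty
  · rw [← closure_interior_hullOutside_diff hgen hQ
      (𝒜 := {B | (Q, B) ∈ basicTiles (projLift a) h}) fun B hB => mem_delaunaySimplices_of_mem_basicTiles hgen hB, linkRegion]
    congr 3
    ext x
    simp only [linkPart, Set.mem_iUnion]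
    constructor
    · rintro ⟨r, hr, t, ⟨⟨htP, hcard⟩, htr, hdis, hsub⟩, hx⟩
      refine ⟨t.2, ⟨⟨htP.1, hdis, by rw [← htP.2]; exact hsub⟩, fun hmem => ?_⟩, hx⟩
      have : Q = t.1 := hmem.2.trans htP.2.symm
      rw [this] at hcard
      exact lt_irrefl _ hcard
    · rintro ⟨B, ⟨hB, hBn⟩, hx⟩
      have hlt : (aboveSet (projLift a) h (interpolant (projLift a) h B)).card < Q.card :=
        Finset.card_lt_card (hB.2.2.ssubset_of_ne fun heq => hBn ⟨hB.1, heq.symm⟩)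
      exact ⟨_, Finset.mem_range.2 hlt, (aboveSet (projLift a) h (interpolant (projLift a) h B), B),
        ⟨⟨⟨hB.1, rfl⟩, hlt⟩, rfl, hB.2.1, hB.2.2⟩, hx⟩
  · have h1 : linkRegion a {t ∈ basicTiles (projLift a) h | t.1.card < Q.card} Q = ∅ := by
      rw [linkRegion, closure_empty_iff, ← Set.subset_empty_iff]
      exact (interior_mono Set.sdiff_subset).trans (Set.not_nonempty_iff_eq_empty.1 hQ).subset
    have h2 : {B | (Q, B) ∈ basicTiles (projLift a) h} = ∅ := by
      rw [Set.eq_empty_iff_forall_notMem]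
      exact fun B hB => hQ (interior_hullOutside_nonempty (t := (Q, B)) hgen hB)
    rw [h1, h2]
    simp

lemma linkRegion_basicTiles_nonempty_iff (hgen : IsGenericValue (projLift a) h)
    (Q : Finset (Fin n)) :
    (linkRegion a {t ∈ basicTiles (projLift a) h | t.1.card < Q.card} Q).Nonempty ↔
      ∃ B, (Q, B) ∈ basicTiles (projLift a) h := by
  rw [linkRegion_basicTiles hgen]
  simp only [Set.nonempty_iUnion]
  constructor
  · rintro ⟨B, hB, -⟩
    exact ⟨B, hB⟩
  · rintro ⟨B, hB⟩
    exact ⟨B, hB,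
      (interior_simplexOf_nonempty_iff.2 hB.1.isSpanningIndex).mono interior_subset⟩

variable {T : Finset (Fin n) → Set (Finset (Fin n))}

lemma linkSimplices_basicTiles (hgen : IsGenericValue (projLift a) h) {Q : Finset (Fin n)}
    (hT : T Q = delaunaySimplices a h Q) :
    linkSimplices a T {t ∈ basicTiles (projLift a) h | t.1.card < Q.card} Q =
      {B | (Q, B) ∈ basicTiles (projLift a) h} := by
  have hsub : {B | (Q, B) ∈ basicTiles (projLift a) h} ⊆ delaunaySimplices a h Q :=
    fun B hB => mem_delaunaySimplices_of_mem_basicTiles hgen hB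
  ext B
  rw [linkSimplices, linkRegion_basicTiles hgen, hT]
  constructor
  · rintro ⟨hB, hBsub⟩
    exact mem_of_simplexOf_subset hgen hB hsub hBsub
  · intro hB
    exact ⟨hsub hB, Set.subset_biUnion_of_mem (u := simplexOf a) hB⟩

lemma newTiles_basicTiles (hgen : IsGenericValue (projLift a) h)
    (hT : ∀ Q, (interior (hullOutside a Q)).Nonempty → T Q = delaunaySimplices a h Q) (k : ℕ) :
    newTiles a T {I | I.card = k ∧ ∃ B, (I, B) ∈ basicTiles (projLift a) h}
      {t ∈ basicTiles (projLift a) h | t.1.card < k} =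
      {t ∈ basicTiles (projLift a) h | t.1.card = k} := by
  ext t
  constructor
  · rintro ⟨⟨rfl, B, hB⟩, ht⟩
    rw [linkSimplices_basicTiles hgen (hT _ (interior_hullOutside_nonempty hgen hB))] at ht
    exact ⟨ht, rfl⟩
  · rintro ⟨ht, rfl⟩
    refine ⟨⟨rfl, t.2, ht⟩, ?_⟩
    rw [linkSimplices_basicTiles hgen (hT _ (interior_hullOutside_nonempty hgen ht))]
    exact ht

/-- Nonemptiness of the link region discards the candidates that label no tile, and
`exists_lower_tile` shows that no label is missed. -/
lemma constructionState_eq (hgen : IsGenericValue (projLift a) h)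
    (hspan : IsSpanningIndex (projLift a) Finset.univ)
    (hT : ∀ Q, (interior (hullOutside a Q)).Nonempty → T Q = delaunaySimplices a h Q) (k : ℕ) :
    constructionState a T k =
      ({I | I.card = k ∧ ∃ B, (I, B) ∈ basicTiles (projLift a) h},
        {t ∈ basicTiles (projLift a) h | t.1.card < k}) := by
  induction k with
  | zero =>
    refine Prod.ext (Set.ext fun I => ?_) (by simp [constructionState])
    have hint : (interior (hullOutside a ∅)).Nonempty := by
      rw [hullOutside_eq, Finset.compl_empty]
      exact interior_simplexOf_nonempty_iff.2 hspan
    constructor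
    · rintro rfl
      refine ⟨rfl, ?_⟩
      -- A Delaunay simplex of the whole configuration has empty above set, so it carries a tile of
      -- order 0.
      have h1 := hint.mono interior_subset
      rw [← iUnion_delaunaySimplices hgen hint] at h1
      obtain ⟨B, hB, -⟩ := Set.nonempty_biUnion.1 h1
      exact ⟨B, hB.1, (Finset.subset_empty.1 hB.2.2).symm⟩
    · rintro ⟨hI, -⟩
      exact Finset.card_eq_zero.1 hI
  | succ k ih =>
    rw [constructionState, ih]
    dsimp only
    rw [newTiles_basicTiles hgen hT]
    have hunion : {t ∈ basicTiles (projLift a) h | t.1.card < k} ∪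
        {t ∈ basicTiles (projLift a) h | t.1.card = k} =
        {t ∈ basicTiles (projLift a) h | t.1.card < k + 1} := by
      ext t
      simp only [Set.mem_union, Set.mem_ofPred_eq, ← and_or_left, Nat.lt_succ_iff_lt_or_eq]
    rw [hunion]
    refine Prod.ext (Set.ext fun J => ?_) rfl
    constructor
    · rintro ⟨t, ⟨ht, rfl⟩, b, hb, rfl, hne⟩
      have hbt : b ∉ t.1 := Finset.disjoint_right.1 (disjoint_of_mem_basicTiles hgen ht) hb
      have hcard := Finset.card_insert_of_notMem hbt
      rw [← hcard, linkRegion_basicTiles_nonempty_iff hgen] at hne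
      exact ⟨hcard, hne⟩
    · rintro ⟨hJ, B, hB⟩
      obtain ⟨t, ht, j, hj, hjt, hins⟩ := exists_lower_tile hgen hB
        (Finset.card_pos.1 (by dsimp only; omega)) _ single_last_dotProduct_projLift
      dsimp only at hins
      refine ⟨t, ⟨ht, ?_⟩, j, hj, hins, ?_⟩
      · rw [hins, Finset.card_insert_of_notMem hjt] at hJ
        omega
      · rw [← hJ, linkRegion_basicTiles_nonempty_iff hgen]
        exact ⟨B, hB⟩

lemma card_add_le_of_mem_basicTiles (hgen : IsGenericValue (projLift a) h) {t : TileLabel n}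
    (ht : t ∈ basicTiles (projLift a) h) : t.1.card + d + 1 ≤ n := by
  have h1 := Finset.card_union_of_disjoint (disjoint_of_mem_basicTiles hgen ht)
  have h2 := Finset.card_le_univ (t.1 ∪ t.2)
  rw [h1, ht.1.1, Fintype.card_fin] at h2
  omega

end

/-! ### The main theorem -/

theorem theorem5 {d n : ℕ} (a : Fin n → Fin d → ℝ)
    (hspan : affineSpan ℝ (Set.range a) = ⊤)
    (h : Fin n → ℝ) (hgen : IsGenericHeight a h) :
    -- the weighted Delaunay triangulation of `ch_Q(A)` exists and is unique
    (∀ Q : Finset (Fin n), (interior (hullOutside a Q)).Nonempty →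
      ∃! T : Set (Finset (Fin n)), IsWeightedDelaunay a h Q (hullOutside a Q) T) ∧
    -- the construction with these triangulations
    ∀ T : Finset (Fin n) → Set (Finset (Fin n)),
      (∀ Q : Finset (Fin n), (interior (hullOutside a Q)).Nonempty →
        IsWeightedDelaunay a h Q (hullOutside a Q) (T Q)) →
      -- no step fails: every link region met is triangulated by the simplices of `T I` in it
      (∀ k : ℕ, k + d + 1 ≤ n → ∀ I ∈ indexFamily a T k,
        (interior (hullOutside a I)).Nonempty ∧
        (linkRegion a (tilesBefore a T k) I).Nonempty ∧
        IsWeightedDelaunay a h I (linkRegion a (tilesBefore a T k) I)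
          (linkSimplices a T (tilesBefore a T k) I)) ∧
      -- the construction stops after step `n - d - 1`
      indexFamily a T (n - d) = ∅ ∧
      -- the result is a regular fine zonotopal tiling, with the tiles of order `k` from step `k`
      IsFineZonotopalTiling a (constructedTiles a T) ∧
      (∀ k : ℕ, k + d + 1 ≤ n →
        tilesAt a T k = {t ∈ constructedTiles a T | t.1.card = k}) ∧
      IsRegularTiling a (constructedTiles a T) ∧
      -- it is the projection of the lower hull of the lifted zonotope
      constructedTiles a T = lowerHullLabels a h ∧
      tileSet (projLift a) '' constructedTiles a T =
        {G | ∃ F, IsLowerFacet (zonotope (fullLift a h)) F ∧ G = dropHeight '' F} := by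
  have hg := isGenericValue_of_isGenericHeight hgen
  have hsp : IsSpanningIndex (projLift a) Finset.univ := by
    rw [← affineSpan_image_eq_top_iff, Finset.coe_univ, Set.image_univ]
    exact hspan
  refine ⟨fun Q hQ => existsUnique_isWeightedDelaunay hg hQ, fun T hT => ?_⟩
  have hT' : ∀ Q, (interior (hullOutside a Q)).Nonempty → T Q = delaunaySimplices a h Q :=
    fun Q hQ => eq_delaunaySimplices hg (hT Q hQ)
  have hfam : ∀ k, indexFamily a T k =
      {I | I.card = k ∧ ∃ B, (I, B) ∈ basicTiles (projLift a) h} :=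
    fun k => congrArg Prod.fst (constructionState_eq hg hsp hT' k)
  have hbefore : ∀ k, tilesBefore a T k = {t ∈ basicTiles (projLift a) h | t.1.card < k} :=
    fun k => congrArg Prod.snd (constructionState_eq hg hsp hT' k)
  have hat : ∀ k, tilesAt a T k = {t ∈ basicTiles (projLift a) h | t.1.card = k} := fun k => by
    rw [tilesAt, hfam, hbefore, newTiles_basicTiles hg hT']
  have hall : constructedTiles a T = basicTiles (projLift a) h := by
    ext t
    simp only [constructedTiles, hat, Set.mem_iUnion]
    constructor
    · rintro ⟨k, -, ht, -⟩
      exact ht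
    · intro ht
      exact ⟨_, card_add_le_of_mem_basicTiles hg ht, ht, rfl⟩
  rw [hall]
  refine ⟨?_, ?_, isFineZonotopalTiling_basicTiles hg hsp, fun k _ => hat k,
    isRegularTiling_basicTiles hg, (lowerHullLabels_eq hg).symm, image_tileSet_basicTiles hg⟩
  · intro k _ I hI
    rw [hfam] at hI
    obtain ⟨rfl, B, hB⟩ := hI
    have hint := interior_hullOutside_nonempty hg hB
    rw [hbefore, linkSimplices_basicTiles hg (hT' I hint)]
    exact ⟨hint, (linkRegion_basicTiles_nonempty_iff hg I).2 ⟨B, hB⟩,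
      isWeightedDelaunay_of_subset hg
        (fun B hB => mem_delaunaySimplices_of_mem_basicTiles hg hB)
        (linkRegion_basicTiles hg I).symm⟩
  -- Truncation of `n - d` is harmless: a tile needs `d + 1` free indices besides `I`, which is
  -- impossible also when `n < d`.
  · rw [hfam, Set.eq_empty_iff_forall_notMem]
    rintro I ⟨hI, B, hB⟩
    have := card_add_le_of_mem_basicTiles hg hB
    dsimp only at this
    omega
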